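/- An MV-algebra is an algebra $\langle A,\oplus,\neg,0\rangle$ such that $\langle A,\oplus,0\rangle$ is a commutative monoid, $\neg\neg x\approx x$, $x\oplus\neg 0\approx\neg 0$ and $\neg(\neg x\oplus y)\oplus y\approx\neg(\neg y\oplus x)\oplus x$; put $1:=\neg 0$, $x\to y:=\neg x\oplus y$, $x*y:=\neg(\neg x\oplus\neg y)$, $x\vee y:=(x\to y)\to y$. A monadic MV-algebra is an algebra $\langle A,\oplus,\neg,0,\exists,\forall\rangle$ whose reduct $\langle A,\oplus,\neg,0\rangle$ is an MV-algebra and which satisfies the identities $$\forall x\to x\approx 1,\quad \forall(x\to\forall y)\approx\exists x\to\forall y,\quad \forall(\forall x\to y)\approx\forall x\to\forall y,\quad \forall(\exists x\vee y)\approx\exists x\vee\forall y,\quad \exists(x*x)\approx\exists x*\exists x .$$ Let $\mathbb{MMV}$ be the class of all monadic MV-algebras. A quasivariety is a class of algebras of this signature axiomatized by a set of quasi-identities $s_1\approx t_1\mathbin{\&}\dots\mathbin{\&}s_n\approx t_n\Rightarrow s\approx t$ ($n\ge 0$), and the quasivariety generated by a class $K$ is the least quasivariety containing $K$. Let $[0,1]_{\text{Ł}}$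 be the MV-algebra on the real unit interval with $x\oplus y=\min(1,x+y)$ and $\neg x=1-x$, and for $m\ge 1$ let $\mathbf L_m$ be the $(m+1)$-element MV-chain (the subalgebra $\{0,\tfrac1m,\dots,\tfrac{m-1}m,1\}$ of $[0,1]_{\text{Ł}}$, up to isomorphism). For $\mathbf C$ one of these chains and a non-empty set $X$, let $\langle\mathbf C^X,\exists_\vee,\forall_\wedge\rangle$ be the algebra of all functions $X\to C$ with pointwise MV-operations and, for all $x \in X$, $$\exists_\vee(f)(x)=\bigvee\{f(y):y\in X\},\qquad \forall_\wedge(f)(x)=\bigwedge\{f(y):y\in X\};$$ write $k$ in place of $X$ when $|X|=k$ is finite, and $\omega$ when $X=\mathbb N$. Then: 1. $\mathbb{MMV}$ is generated as a quasivariety by the algebras $\langle\mathbf L_m^\omega,\exists_\vee,\forall_\wedge\rangle$, $m\ge 1$. 2. $\mathbb{MMV}$ is generated as a quasivariety by the algebras $\langle[0,1]_{\text{Ł}}^k,\exists_\vee,\forall_\wedge\rangle$, $k\ge 1$. 3. $\mathbb{MMV}$ is generated as a quasivariety by the single algebra $\langle[0,1]_{\text{Ł}}^\omega,\exists_\vee,\forall_\wedge\rangle$.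 -/

import Mathlib

open FirstOrder FirstOrder.Language CategoryTheory

universe u

/-- The operation symbols of monadic MV-algebras: the MV-operations `0`, `¬`, `⊕` and the two
quantifiers `∃`, `∀`, with their arities. -/
inductive MonadicMVFunc : ℕ → Type
  | zero : MonadicMVFunc 0
  | neg : MonadicMVFunc 1
  | plus : MonadicMVFunc 2
  | ex : MonadicMVFunc 1
  | all : MonadicMVFunc 1

/-- The algebraic signature of monadic MV-algebras. -/
def monadicMVLang : FirstOrder.Language.{0, 0} := ⟨MonadicMVFunc, fun _ => Empty⟩

/-- An arbitrary algebra of this signature, with carrier in `Type u`. -/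
abbrev MonadicMVAlg : Type (u + 1) := Bundled.{u} monadicMVLang.Structure

namespace MonadicMV

section Operations

variable {A : Type u} [monadicMVLang.Structure A]

/-- The constant `0`. -/
def zero : A := Structure.funMap (L := monadicMVLang) MonadicMVFunc.zero ![]

/-- Negation `¬ x`. -/
def neg (x : A) : A := Structure.funMap (L := monadicMVLang) MonadicMVFunc.neg ![x]

/-- Truncated sum `x ⊕ y`. -/
def plus (x y : A) : A := Structure.funMap (L := monadicMVLang) MonadicMVFunc.plus ![x, y]

/-- The quantifier `∃ x`. -/
def ex (x : A) : A := Structure.funMap (L := monadicMVLang) MonadicMVFunc.ex ![x]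

/-- The quantifier `∀ x`. -/
def all (x : A) : A := Structure.funMap (L := monadicMVLang) MonadicMVFunc.all ![x]

/-- `1 = ¬ 0`. -/
def one : A := neg zero

/-- `x → y = ¬ x ⊕ y`. -/
def imp (x y : A) : A := plus (neg x) y

/-- `x * y = ¬ (¬ x ⊕ ¬ y)`. -/
def mul (x y : A) : A := neg (plus (neg x) (neg y))

/-- `x ∨ y = (x → y) → y`. -/
def join (x y : A) : A := imp (imp x y) y

end Operations

/-- The defining identities of MV-algebras (for the reduct `⟨A, ⊕, ¬, 0⟩`). -/
structure IsMV (A : Type u) [monadicMVLang.Structure A] : Prop where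
  plus_assoc : ∀ x y z : A, plus x (plus y z) = plus (plus x y) z
  plus_comm : ∀ x y : A, plus x y = plus y x
  plus_zero : ∀ x : A, plus x zero = x
  neg_neg : ∀ x : A, neg (neg x) = x
  plus_one : ∀ x : A, plus x (neg zero) = neg zero
  lukasiewicz : ∀ x y : A, plus (neg (plus (neg x) y)) y = plus (neg (plus (neg y) x)) x

/-- Monadic MV-algebras: MV-algebras with two unary operations `∃`, `∀` satisfying (M1)-(M5). -/
structure IsMonadicMV (A : Type u) [monadicMVLang.Structure A] : Prop extends IsMV A where
  m1 : ∀ x : A, imp (all x) x = one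
  m2 : ∀ x y : A, all (imp x (all y)) = imp (ex x) (all y)
  m3 : ∀ x y : A, all (imp (all x) y) = imp (all x) (all y)
  m4 : ∀ x y : A, all (join (ex x) y) = join (ex x) (all y)
  m5 : ∀ x : A, ex (mul x x) = mul (ex x) (ex x)

end MonadicMV

/-- The class `MMV` of all monadic MV-algebras. -/
def MMV : Set MonadicMVAlg.{u} := {A | MonadicMV.IsMonadicMV A}

/-- A quasi-identity `s₁ ≈ t₁ & ... & sₙ ≈ tₙ ⇒ s ≈ t` (with `n = 0` allowed), in variables
indexed by `ℕ`. -/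
structure QuasiIdentity where
  /-- The pairs `(sᵢ, tᵢ)`. -/
  premises : List (monadicMVLang.Term ℕ × monadicMVLang.Term ℕ)
  /-- The term `s`. -/
  lhs : monadicMVLang.Term ℕ
  /-- The term `t`. -/
  rhs : monadicMVLang.Term ℕ

/-- Validity of a quasi-identity in an algebra. -/
def QuasiIdentity.HoldsIn (q : QuasiIdentity) (A : MonadicMVAlg.{u}) : Prop :=
  ∀ v : ℕ → A, (∀ p ∈ q.premises, p.1.realize v = p.2.realize v) →
    q.lhs.realize v = q.rhs.realize v

/-- A quasivariety is a class of algebras axiomatized by a set of quasi-identities. -/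
def IsQuasivariety (Q : Set MonadicMVAlg.{u}) : Prop :=
  ∃ Θ : Set QuasiIdentity, Q = {A | ∀ q ∈ Θ, q.HoldsIn A}

/-- `Q` is the quasivariety generated by the class `K`: the least quasivariety containing `K`. -/
def IsGeneratedAsQuasivarietyBy (Q K : Set MonadicMVAlg.{u}) : Prop :=
  IsLeast {R | IsQuasivariety R ∧ K ⊆ R} Q

/-- The MV-operations on the standard chains. -/
class MVOps (C : Type) where
  /-- The constant `0`. -/
  zero : C
  /-- Negation. -/
  neg : C → C
  /-- Truncated sum. -/
  plus : C → C → C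

/-- The standard MV-algebra on `[0,1]`: `¬ x = 1 - x` and `x ⊕ y = min (1, x + y)`. -/
noncomputable instance unitIntervalMVOps : MVOps unitInterval where
  zero := 0
  neg x := ⟨1 - x, sub_nonneg.mpr x.2.2, sub_le_self 1 x.2.1⟩
  plus x y := ⟨min 1 ((x : ℝ) + y),
    le_min zero_le_one (add_nonneg x.2.1 y.2.1), min_le_left _ _⟩

/-- The `(m+1)`-element MV-chain, with `j : Fin (m + 1)` standing for `j / m`:
`¬ j = m - j` and `i ⊕ j = min (m, i + j)`. -/
instance finMVOps (m : ℕ) : MVOps (Fin (m + 1)) where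
  zero := 0
  neg j := ⟨m - j, by omega⟩
  plus i j := ⟨min m ((i : ℕ) + j), by omega⟩

/-- The structure `⟨C^X, ∃_∨, ∀_∧⟩` on the set of all functions from `X` to a complete chain `C`:
the MV-operations are pointwise, and `∃ f`, `∀ f` are the constant functions with values the
supremum and the infimum of `f`. -/
noncomputable abbrev functionStructure (C : Type) [CompleteLinearOrder C] [MVOps C]
    (X : Type u) : monadicMVLang.Structure (X → C) where
  funMap := fun {_} F => match F with
    | MonadicMVFunc.zero => fun _ _ => MVOps.zero
    | MonadicMVFunc.neg => fun a x => MVOps.neg (a 0 x)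
    | MonadicMVFunc.plus => fun a x => MVOps.plus (a 0 x) (a 1 x)
    | MonadicMVFunc.ex => fun a _ => ⨆ y, a 0 y
    | MonadicMVFunc.all => fun a _ => ⨅ y, a 0 y
  RelMap := fun r => r.elim

/-- The algebra `⟨C^X, ∃_∨, ∀_∧⟩`. -/
noncomputable def functionAlgebra (C : Type) [CompleteLinearOrder C] [MVOps C] (X : Type u) :
    MonadicMVAlg.{u} :=
  ⟨X → C, functionStructure C X⟩

/-! `MMV` is defined by identities, so it is a quasivariety, and it contains the generating algebras
because the operations of a complete MV-chain are residuated. It remains to show that a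
quasi-identity failing in some monadic MV-algebra `A` fails in a generator. The failure involves
only the finite set `S` of values of subterms, so it is enough to separate two elements `x ≠ y` of
`S`, say with `x - y ≠ 0`, by a map into some `L_m^ι` with `ι` finite that respects the operations
as far as they stay within `S`.

Choose a prime ideal `J` of the algebra of quantifier-fixed elements that omits `∃(x - y)`. The key
lemma `exists_isPrimeIdeal_witness` gives, for each `t`, a prime ideal `I t` of `A` with trace `J`
on the fixed elements and containing `∃t - t`; so in the chain `A / I t` the element `t` attains the
value of `∃t`. Finitely many `t` supply witnesses for every `∃a` and, by duality, every `∀a` with `a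
∈ S`.

These chains share the subchain of fixed elements modulo `J`, so their Chang groups are totally
ordered groups over a common subgroup. No amalgam is needed: `exists_int_realization` replaces the
finitely many relevant elements by integers that keep all required inequalities and agree across the
chains on shared elements. The consistency of this linear system is checked in the groups, and
Fourier-Motzkin elimination solves it. The common integer value of `⊤` is `m`. Reindexing along a
surjection `X → ι` leaves suprema and infima unchanged, and `L_m` embeds in the unit interval; this
covers all three families. -/

/-! ### Order and arithmetic of MV-algebras -/

/-- MV-algebras, written additively with `xᶜ` for the negation. -/
class MVAlgebra (A : Type*) extends AddCommMonoid A, Compl A where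
  compl_compl_eq : ∀ x : A, xᶜᶜ = x
  add_compl_zero : ∀ x : A, x + 0ᶜ = 0ᶜ
  lukasiewicz : ∀ x y : A, (xᶜ + y)ᶜ + y = (yᶜ + x)ᶜ + x

namespace MVAlgebra

variable {A : Type*} [MVAlgebra A]

instance : Sub A := ⟨fun x y => (xᶜ + y)ᶜ⟩

instance : Top A := ⟨0ᶜ⟩

theorem sub_def (x y : A) : x - y = (xᶜ + y)ᶜ := rfl

theorem top_def : (⊤ : A) = 0ᶜ := rfl

@[simp] theorem compl_compl' (x : A) : xᶜᶜ = x := compl_compl_eq x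

@[simp] theorem compl_top' : (⊤ : A)ᶜ = 0 := compl_compl_eq 0

@[simp] theorem compl_zero' : (0 : A)ᶜ = ⊤ := rfl

@[simp] theorem add_top' (x : A) : x + ⊤ = ⊤ := add_compl_zero x

@[simp] theorem top_add' (x : A) : ⊤ + x = ⊤ := by rw [add_comm, add_top']

theorem compl_add_self (x : A) : xᶜ + x = ⊤ := by
  have h := lukasiewicz x (⊤ : A)
  simpa using h.symm

theorem sub_add_comm' (x y : A) : x - y + y = y - x + x := lukasiewicz x y

instance : LE A := ⟨fun x y => x - y = 0⟩

theorem le_def {x y : A} : x ≤ y ↔ x - y = 0 := Iff.rfl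

theorem le_iff_compl_add {x y : A} : x ≤ y ↔ xᶜ + y = ⊤ := by
  rw [le_def, sub_def]
  constructor
  · intro h
    rw [← compl_compl' (xᶜ + y), h, compl_zero']
  · intro h
    rw [h, compl_top']

theorem le_add_right' (x c : A) : x ≤ x + c := by
  rw [le_iff_compl_add, ← add_assoc, compl_add_self, top_add']

theorem sub_add_of_le {x y : A} (h : x ≤ y) : y - x + x = y := by
  rw [sub_add_comm', le_def.1 h, zero_add]

instance : PartialOrder A where
  le_refl x := by rw [le_iff_compl_add, compl_add_self]
  le_trans x y z h h' := by
    rw [← sub_add_of_le h', ← sub_add_of_le h, add_comm, add_comm _ x, add_assoc]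
    exact le_add_right' _ _
  le_antisymm x y h h' := by
    rw [← sub_add_of_le h', le_def.1 h, zero_add]

instance : IsOrderedAddMonoid A where
  add_le_add_left x y h z := by
    rw [← sub_add_of_le h, add_comm _ x, add_right_comm]
    exact le_add_right' _ _

instance : CanonicallyOrderedAdd A where
  exists_add_of_le {x y} h := ⟨y - x, by rw [add_comm, sub_add_of_le h]⟩
  le_add_self x y := by rw [add_comm]; exact le_add_right' x y
  le_self_add := le_add_right'

instance : OrderedSub A where
  tsub_le_iff_right x y z := by
    rw [le_iff_compl_add, le_iff_compl_add, sub_def, compl_compl', add_comm z, add_assoc]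

instance : OrderTop A where
  le_top x := by rw [le_iff_compl_add, add_top']

theorem compl_le_compl' {x y : A} (h : x ≤ y) : yᶜ ≤ xᶜ := by
  rw [le_iff_compl_add] at *
  rwa [compl_compl', add_comm]

theorem compl_le_compl_iff' {x y : A} : yᶜ ≤ xᶜ ↔ x ≤ y :=
  ⟨fun h => by simpa using compl_le_compl' h, compl_le_compl'⟩

theorem compl_sub_compl (x y : A) : xᶜ - yᶜ = y - x := by
  rw [sub_def, sub_def, compl_compl', add_comm]

theorem compl_add (x y : A) : (x + y)ᶜ = xᶜ - y := by rw [sub_def, compl_compl']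

theorem add_eq_top_iff {x y : A} : x + y = ⊤ ↔ xᶜ ≤ y := by
  rw [le_iff_compl_add, compl_compl']

theorem sup_le' {x y z : A} (hx : x ≤ z) (hy : y ≤ z) : x - y + y ≤ z :=
  calc x - y + y ≤ z - y + y := by gcongr
    _ = z := sub_add_of_le hy

/-- The lattice meet. -/
def meet (x y : A) : A := x - (x - y)

theorem meet_def (x y : A) : meet x y = x - (x - y) := rfl

/-- De Morgan: the Łukasiewicz axiom makes the join symmetric, and this form carries the symmetry
over to the meet. -/
theorem meet_eq_compl (x y : A) : meet x y = (yᶜ - xᶜ + xᶜ)ᶜ := by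
  rw [compl_sub_compl, meet_def, sub_def x (x - y), add_comm]

theorem meet_comm (x y : A) : meet x y = meet y x := by
  rw [meet_eq_compl, meet_eq_compl, sub_add_comm']

theorem meet_le_left (x y : A) : meet x y ≤ x := tsub_le_self

theorem meet_le_right (x y : A) : meet x y ≤ y := meet_comm x y ▸ meet_le_left y x

theorem le_meet {x y z : A} (hx : z ≤ x) (hy : z ≤ y) : z ≤ meet x y := by
  rw [meet_eq_compl, ← compl_le_compl_iff', compl_compl']
  exact sup_le' (compl_le_compl' hy) (compl_le_compl' hx)

theorem sub_add_meet (x y : A) : x - y + meet x y = x := by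
  rw [add_comm]; exact sub_add_of_le tsub_le_self

theorem meet_mono {x y x' y' : A} (hx : x ≤ x') (hy : y ≤ y') : meet x y ≤ meet x' y' :=
  le_meet ((meet_le_left x y).trans hx) ((meet_le_right x y).trans hy)

/-- Measures how far truncated addition fails to be cancellative: nothing is lost exactly when `z`
lies below `mᶜ`. -/
theorem add_sub_self_eq_meet (z m : A) : z + m - m = meet z mᶜ := by
  rw [meet_eq_compl, compl_compl', sub_add_comm', ← compl_add, sub_def]

theorem add_sub_cancel_of_le {z m : A} (h : z ≤ mᶜ) : z + m - m = z := by
  rw [add_sub_self_eq_meet]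
  exact le_antisymm (meet_le_left _ _) (le_meet le_rfl h)

/-- Prelinearity, the source of all chain quotients. Adding `z` to `meet x y` stays below both `x`
and `y`, hence below `meet x y`; since `z` also lies below the complement of `meet x y`, it can be
cancelled to give `z ≤ 0`. -/
theorem meet_sub_sub (x y : A) : meet (x - y) (y - x) = 0 := by
  set z := meet (x - y) (y - x)
  have key : ∀ x y : A, z ≤ x - y → z + meet x y ≤ x := fun x y h =>
    calc z + meet x y ≤ x - y + meet x y := by gcongr
      _ = x := sub_add_meet x y
  have h1 := key x y (meet_le_left _ _)
  have h2 := key y x (meet_le_right _ _)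
  rw [meet_comm] at h2
  have h3 : z + meet x y ≤ 0 + meet x y := by rw [zero_add]; exact le_meet h1 h2
  have h4 : z ≤ (meet x y)ᶜ := calc
    z ≤ x - y := meet_le_left _ _
    _ = yᶜ - xᶜ := (compl_sub_compl _ _).symm
    _ ≤ yᶜ := tsub_le_self
    _ ≤ _ := compl_le_compl' (meet_le_right _ _)
  rw [← nonpos_iff_eq_zero, ← add_sub_cancel_of_le h4]
  exact tsub_le_iff_right.2 h3

theorem meet_add_le (z w a : A) : meet (z + w) a ≤ meet z a + meet w a := by
  set t := meet (z + w) a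
  have ht : t ≤ z + w := meet_le_left _ _
  have ha : t ≤ a := meet_le_right _ _
  calc t = t - w + meet t w := (sub_add_meet t w).symm
    _ ≤ meet z a + meet w a := by
      refine add_le_add (le_meet (tsub_le_iff_right.2 ht) (tsub_le_self.trans ha)) ?_
      exact le_meet (meet_le_right _ _) ((meet_le_left _ _).trans ha)

/-! ### Ideals, prime ideals and chain quotients -/

/-- Ideals of an MV-algebra. -/
structure IsIdeal (I : Set A) : Prop where
  zero_mem : (0 : A) ∈ I
  add_mem : ∀ {x y : A}, x ∈ I → y ∈ I → x + y ∈ I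
  mem_of_le : ∀ {x y : A}, x ≤ y → y ∈ I → x ∈ I

/-- Proper prime ideals: those whose quotient is a non-trivial chain. -/
structure IsPrimeIdeal (I : Set A) : Prop extends IsIdeal I where
  top_notMem : (⊤ : A) ∉ I
  total : ∀ x y : A, x - y ∈ I ∨ y - x ∈ I

theorem IsPrimeIdeal.mem_or_mem {I : Set A} (hI : IsPrimeIdeal I) {x y : A}
    (h : meet x y ∈ I) : x ∈ I ∨ y ∈ I := by
  rcases hI.total x y with h' | h'
  · left; rw [← sub_add_meet x y]; exact hI.add_mem h' h
  · right; rw [← sub_add_meet y x, meet_comm]; exact hI.add_mem h' h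

theorem isIdeal_colon {I : Set A} (hI : IsIdeal I) (a : A) : IsIdeal {z | meet z a ∈ I} where
  zero_mem := hI.mem_of_le (meet_le_left _ _) hI.zero_mem
  add_mem hx hy := hI.mem_of_le (meet_add_le _ _ _) (hI.add_mem hx hy)
  mem_of_le h hy := hI.mem_of_le (meet_mono h le_rfl) hy

/-- Prime ideal theorem: an ideal maximal among those disjoint from `D` is prime. If neither `x - y`
nor `y - x` belonged to it, two successive colon ideals would be strictly larger and so meet `D`,
producing a meet of two elements of `D` inside the ideal. -/
theorem exists_isPrimeIdeal {I₀ D : Set A} (hI₀ : IsIdeal I₀) (hD : D.Nonempty)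
    (hmeet : ∀ x ∈ D, ∀ y ∈ D, meet x y ∈ D) (hdisj : Disjoint I₀ D) :
    ∃ I : Set A, IsPrimeIdeal I ∧ I₀ ⊆ I ∧ Disjoint I D := by
  obtain ⟨P, hsub, hP⟩ := zorn_subset_nonempty {I : Set A | IsIdeal I ∧ Disjoint I D}
    (fun c hc hchain hne => by
      refine ⟨⋃₀ c, ⟨⟨?_, ?_, ?_⟩, ?_⟩, fun s hs => Set.subset_sUnion_of_mem hs⟩
      · obtain ⟨s, hs⟩ := hne
        exact ⟨s, hs, (hc hs).1.zero_mem⟩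
      · rintro x y ⟨s, hs, hx⟩ ⟨t, ht, hy⟩
        rcases hchain.total hs ht with h | h
        · exact ⟨t, ht, (hc ht).1.add_mem (h hx) hy⟩
        · exact ⟨s, hs, (hc hs).1.add_mem hx (h hy)⟩
      · rintro x y hxy ⟨s, hs, hy⟩
        exact ⟨s, hs, (hc hs).1.mem_of_le hxy hy⟩
      · rw [Set.disjoint_sUnion_left]
        exact fun s hs => (hc hs).2) I₀ ⟨hI₀, hdisj⟩
  have hId := hP.prop.1
  have hPD := hP.prop.2
  have colon : ∀ a b : A, meet b a ∈ P → b ∉ P → ∃ z ∈ D, meet z a ∈ P := by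
    intro a b hab hb
    by_contra! hcon
    have hle : P ⊆ {z | meet z a ∈ P} := fun z hz => hId.mem_of_le (meet_le_left _ _) hz
    have := hP.le_of_ge (y := {z | meet z a ∈ P}) ⟨isIdeal_colon hId a,
      Set.disjoint_left.2 fun z hz hzD => hcon z hzD hz⟩ hle
    exact hb (this hab)
  refine ⟨P, ⟨hId, ?_, ?_⟩, hsub, hPD⟩
  · intro htop
    obtain ⟨d, hd⟩ := hD
    exact Set.disjoint_left.1 hPD (hId.mem_of_le le_top htop) hd
  · intro x y
    by_contra! hcon
    -- The start is `meet (x - y) (y - x) = 0`: each factor is exchanged in turn for an element of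
    -- `D`.
    obtain ⟨z, hz, hza⟩ := colon (y - x) (x - y) (by
      rw [meet_sub_sub]; exact hId.zero_mem) hcon.1
    obtain ⟨w, hw, hwz⟩ := colon z (y - x) (by rwa [meet_comm]) hcon.2
    exact Set.disjoint_left.1 hPD hwz (hmeet w hw z hz)

/-- The congruence of an ideal. -/
def IsIdeal.addCon {I : Set A} (hI : IsIdeal I) : AddCon A where
  r x y := x - y ∈ I ∧ y - x ∈ I
  iseqv :=
    { refl := fun x => by simpa using hI.zero_mem
      symm := fun h => ⟨h.2, h.1⟩
      trans := fun {x y z} h h' =>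
        ⟨hI.mem_of_le (tsub_le_tsub_add_tsub (b := y)) (hI.add_mem h.1 h'.1),
          hI.mem_of_le (tsub_le_tsub_add_tsub (b := y)) (hI.add_mem h'.2 h.2)⟩ }
  add' {w x y z} h h' :=
    ⟨hI.mem_of_le add_tsub_add_le_tsub_add_tsub (hI.add_mem h.1 h'.1),
      hI.mem_of_le add_tsub_add_le_tsub_add_tsub (hI.add_mem h.2 h'.2)⟩

instance {I : Set A} (hI : IsIdeal I) : MVAlgebra hI.addCon.Quotient where
  compl := Quotient.map' compl fun x y h => by
    change xᶜ - yᶜ ∈ I ∧ yᶜ - xᶜ ∈ I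
    rw [compl_sub_compl, compl_sub_compl]
    exact ⟨h.2, h.1⟩
  compl_compl_eq x := by
    induction x using Quotient.inductionOn'
    exact congrArg _ (compl_compl' _)
  add_compl_zero x := by
    induction x using Quotient.inductionOn'
    exact congrArg _ (add_top' _)
  lukasiewicz x y := by
    induction x using Quotient.inductionOn'
    induction y using Quotient.inductionOn'
    exact congrArg _ (lukasiewicz _ _)

theorem IsIdeal.mk_le_mk {I : Set A} (hI : IsIdeal I) {x y : A} :
    (x : hI.addCon.Quotient) ≤ y ↔ x - y ∈ I := by
  have h : (x : hI.addCon.Quotient) ≤ y ↔ ((x - y : A) : hI.addCon.Quotient) = (0 : A) := Iff.rfl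
  rw [h, AddCon.eq]
  change x - y - 0 ∈ I ∧ 0 - (x - y) ∈ I ↔ _
  simp [hI.zero_mem]

/-- Non-trivial totally ordered MV-algebras. -/
class IsMVChain (C : Type*) [MVAlgebra C] : Prop where
  le_or_le : ∀ x y : C, x ≤ y ∨ y ≤ x
  zero_ne_top : (0 : C) ≠ ⊤

theorem IsPrimeIdeal.isMVChain {I : Set A} (hI : IsPrimeIdeal I) :
    IsMVChain hI.toIsIdeal.addCon.Quotient where
  le_or_le x y := by
    induction x using Quotient.inductionOn'
    induction y using Quotient.inductionOn'
    exact (hI.total _ _).imp hI.mk_le_mk.2 hI.mk_le_mk.2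
  zero_ne_top h := by
    have h' : ((⊤ : A) : hI.addCon.Quotient) ≤ (0 : A) := h.ge
    rw [hI.mk_le_mk] at h'
    exact hI.top_notMem (by simpa using h')

/-- Homomorphisms of MV-algebras. -/
structure IsHom {A B : Type*} [MVAlgebra A] [MVAlgebra B] (f : A → B) : Prop where
  map_zero : f 0 = 0
  map_add : ∀ x y, f (x + y) = f x + f y
  map_compl : ∀ x, f xᶜ = (f x)ᶜ

theorem IsHom.map_top {A B : Type*} [MVAlgebra A] [MVAlgebra B] {f : A → B} (hf : IsHom f) :
    f ⊤ = ⊤ := by rw [top_def, hf.map_compl, hf.map_zero, top_def]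

theorem IsHom.map_sub {A B : Type*} [MVAlgebra A] [MVAlgebra B] {f : A → B} (hf : IsHom f)
    (x y : A) : f (x - y) = f x - f y := by
  rw [sub_def, sub_def, hf.map_compl, hf.map_add, hf.map_compl]

theorem IsHom.monotone {A B : Type*} [MVAlgebra A] [MVAlgebra B] {f : A → B} (hf : IsHom f) :
    Monotone f := by
  intro x y h
  rw [le_def, ← hf.map_sub, le_def.1 h, hf.map_zero]

end MVAlgebra

/-! ### Chang's totally ordered group of an MV-chain -/

/-- The elements of Chang's totally ordered group of an MV-chain `C`: an integral part together
with a proper fractional part in `C`. -/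
@[ext]
structure ChangGroup (C : Type*) [MVAlgebra C] where
  /-- The integral part. -/
  whole : ℤ
  /-- The fractional part. -/
  frac : C
  frac_ne : frac ≠ ⊤

namespace ChangGroup

open MVAlgebra

variable {C : Type*} [MVAlgebra C]

section Chain

/-- `a - bᶜ` is the Łukasiewicz product, that is, the remainder of `a + b` after one unit is
carried. This and the following identities are associativity of addition with carry, split according
to which partial sums overflow. -/
theorem sub_compl_comm (a b : C) : a - bᶜ = b - aᶜ := by
  rw [sub_def, sub_def, add_comm]

theorem sub_compl_sub_compl (a b c : C) : a - bᶜ - cᶜ = a - (b - cᶜ)ᶜ := by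
  rw [sub_def b, compl_compl', tsub_add_eq_tsub_tsub]

theorem sub_compl_add_of_eq_of_eq {a b c : C} (hab : a + b = ⊤) (hbc : b + c = ⊤) :
    a - bᶜ + c = a + (b - cᶜ) := by
  have h1 : bᶜ ≤ a := add_eq_top_iff.1 (by rwa [add_comm])
  have h2 : bᶜ ≤ c := add_eq_top_iff.1 hbc
  rw [sub_compl_comm b c]
  calc a - bᶜ + c = a - bᶜ + (c - bᶜ + bᶜ) := by rw [sub_add_of_le h2]
    _ = a - bᶜ + bᶜ + (c - bᶜ) := by rw [add_comm (c - bᶜ), add_assoc]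
    _ = a + (c - bᶜ) := by rw [sub_add_of_le h1]

theorem ne_top_of_le {a b : C} (h : a ≤ b) (hb : b ≠ ⊤) : a ≠ ⊤ :=
  fun ha => hb (top_le_iff.1 (ha ▸ h))

variable [IsMVChain C]

theorem le_compl_of_add_ne_top {a b : C} (h : a + b ≠ ⊤) : a ≤ bᶜ := by
  rcases IsMVChain.le_or_le a bᶜ with h' | h'
  · exact h'
  · exact absurd (by rw [add_comm]; exact add_eq_top_iff.2 h') h

theorem add_sub_compl_of_ne {a b c : C} (hab : a + b ≠ ⊤) (hbc : b + c ≠ ⊤) :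
    a + b - cᶜ = a - (b + c)ᶜ := by
  have h1 := le_compl_of_add_ne_top hab
  have h2 := le_compl_of_add_ne_top hbc
  rw [add_comm b c, compl_add]
  conv_lhs => rw [← sub_add_of_le h2, tsub_add_eq_tsub_tsub_swap, add_sub_cancel_of_le h1]

theorem sub_compl_add_of_eq_of_ne {a b c : C} (hab : a + b = ⊤) (hbc : b + c ≠ ⊤) :
    a - bᶜ + c = a - (b + c)ᶜ := by
  have h1 : bᶜ ≤ a := add_eq_top_iff.1 (by rwa [add_comm])
  have h2 : c ≤ bᶜ := le_compl_of_add_ne_top (by rwa [add_comm])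
  have hd : bᶜ - c + c = bᶜ := sub_add_of_le h2
  rw [compl_add]
  conv_lhs => rw [← hd, tsub_add_eq_tsub_tsub]
  refine sub_add_of_le ?_
  have h3 : c ≤ (bᶜ - c)ᶜ := by
    rw [sub_def, compl_compl', compl_compl']; exact le_add_self
  calc c = c + (bᶜ - c) - (bᶜ - c) := (add_sub_cancel_of_le h3).symm
    _ ≤ a - (bᶜ - c) := tsub_le_tsub_right (by rw [add_comm, hd]; exact h1) _

end Chain

open Classical in
noncomputable instance : Add (ChangGroup C) where
  add x y := if h : x.frac + y.frac = ⊤ then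
      ⟨x.whole + y.whole + 1, x.frac - y.fracᶜ, ne_top_of_le tsub_le_self x.frac_ne⟩
    else ⟨x.whole + y.whole, x.frac + y.frac, h⟩

theorem add_of_eq {x y : ChangGroup C} (h : x.frac + y.frac = ⊤) :
    x + y = ⟨x.whole + y.whole + 1, x.frac - y.fracᶜ, ne_top_of_le tsub_le_self x.frac_ne⟩ :=
  dif_pos h

theorem add_of_ne {x y : ChangGroup C} (h : x.frac + y.frac ≠ ⊤) :
    x + y = ⟨x.whole + y.whole, x.frac + y.frac, h⟩ :=
  dif_neg h

protected theorem add_comm (x y : ChangGroup C) : x + y = y + x := by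
  by_cases h : x.frac + y.frac = ⊤
  · rw [add_of_eq h, add_of_eq (by rwa [add_comm])]
    ext
    · simp only; ring
    · exact sub_compl_comm _ _
  · rw [add_of_ne h, add_of_ne (by rwa [add_comm])]
    ext
    · simp only; ring
    · exact add_comm _ _

instance : LE (ChangGroup C) :=
  ⟨fun x y => x.whole < y.whole ∨ x.whole = y.whole ∧ x.frac ≤ y.frac⟩

theorem le_def {x y : ChangGroup C} :
    x ≤ y ↔ x.whole < y.whole ∨ x.whole = y.whole ∧ x.frac ≤ y.frac := Iff.rfl

variable [IsMVChain C]

theorem add_assoc_of_eq_of_ne {x y z : ChangGroup C} (hxy : x.frac + y.frac = ⊤)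
    (hyz : y.frac + z.frac ≠ ⊤) : x + y + z = x + (y + z) := by
  have key := sub_compl_add_of_eq_of_ne hxy hyz
  rw [add_of_eq hxy, add_of_ne hyz, add_of_ne, add_of_eq]
  · ext
    · simp only; ring
    · exact key
  · simp only
    rw [← add_assoc, hxy, top_add']
  · simp only
    rw [key]
    exact ne_top_of_le tsub_le_self x.frac_ne

protected theorem add_assoc (x y z : ChangGroup C) : x + y + z = x + (y + z) := by
  by_cases hxy : x.frac + y.frac = ⊤ <;> by_cases hyz : y.frac + z.frac = ⊤
  · have key := sub_compl_add_of_eq_of_eq hxy hyz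
    rw [add_of_eq hxy, add_of_eq hyz]
    by_cases h : x.frac + (y.frac - z.fracᶜ) = ⊤
    · rw [add_of_eq (by simpa only [key] using h), add_of_eq (by simpa only using h)]
      ext
      · simp only; ring
      · exact sub_compl_sub_compl _ _ _
    · rw [add_of_ne (by simpa only [key] using h), add_of_ne (by simpa only using h)]
      ext
      · simp only; ring
      · exact key
  · exact add_assoc_of_eq_of_ne hxy hyz
  -- The mirror image of the previous case, reached by commutativity.
  · rw [ChangGroup.add_comm (x + y), ChangGroup.add_comm x y, ← add_assoc_of_eq_of_ne,
      ChangGroup.add_comm _ x, ChangGroup.add_comm z y]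
    · rwa [add_comm]
    · rwa [add_comm]
  · rw [add_of_ne hxy, add_of_ne hyz]
    by_cases h : x.frac + y.frac + z.frac = ⊤
    · rw [add_of_eq h, add_of_eq (by simpa only [add_assoc] using h)]
      ext
      · simp only; ring
      · exact add_sub_compl_of_ne hxy hyz
    · rw [add_of_ne h, add_of_ne (by simpa only [add_assoc] using h)]
      ext
      · simp only; ring
      · exact add_assoc _ _ _

instance : Zero (ChangGroup C) := ⟨⟨0, 0, IsMVChain.zero_ne_top⟩⟩

open Classical in
noncomputable instance : Neg (ChangGroup C) where
  neg x := if h : x.frac = 0 then ⟨-x.whole, 0, IsMVChain.zero_ne_top⟩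
    else ⟨-x.whole - 1, x.fracᶜ, fun h' => h (by rw [← compl_compl' x.frac, h', compl_top'])⟩

protected theorem zero_add (x : ChangGroup C) : 0 + x = x := by
  have h : (0 : ChangGroup C).frac + x.frac = x.frac := zero_add _
  rw [add_of_ne (by rw [h]; exact x.frac_ne)]
  ext
  · exact zero_add _
  · exact h

protected theorem neg_add_cancel (x : ChangGroup C) : -x + x = 0 := by
  by_cases h : x.frac = 0
  · have hx : -x = ⟨-x.whole, 0, IsMVChain.zero_ne_top⟩ := dif_pos h
    rw [hx, add_of_ne]
    · ext
      · exact neg_add_cancel _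
      · exact (zero_add _).trans h
    · simpa using x.frac_ne
  · have hx : -x = ⟨-x.whole - 1, x.fracᶜ, fun h' => h (by
      rw [← compl_compl' x.frac, h', compl_top'])⟩ := dif_neg h
    rw [hx, add_of_eq (compl_add_self _)]
    ext
    · change -x.whole - 1 + x.whole + 1 = 0
      ring
    · exact tsub_self _

noncomputable instance : AddCommGroup (ChangGroup C) where
  add_assoc := ChangGroup.add_assoc
  zero_add := ChangGroup.zero_add
  add_zero x := by rw [ChangGroup.add_comm, ChangGroup.zero_add]
  nsmul := nsmulRec
  zsmul := zsmulRec
  neg_add_cancel := ChangGroup.neg_add_cancel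
  add_comm := ChangGroup.add_comm

noncomputable instance : LinearOrder (ChangGroup C) where
  le_refl x := Or.inr ⟨rfl, le_rfl⟩
  le_trans x y z h h' := by
    rw [le_def] at *
    rcases h with h | ⟨h, ha⟩ <;> rcases h' with h' | ⟨h', ha'⟩
    · exact Or.inl (h.trans h')
    · exact Or.inl (h' ▸ h)
    · exact Or.inl (h ▸ h')
    · exact Or.inr ⟨h.trans h', ha.trans ha'⟩
  le_antisymm x y h h' := by
    rw [le_def] at *
    rcases h with h | ⟨h, ha⟩ <;> rcases h' with h' | ⟨h', ha'⟩
    · omega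
    · omega
    · omega
    · exact ChangGroup.ext h (le_antisymm ha ha')
  le_total x y := by
    rw [le_def, le_def]
    rcases lt_trichotomy x.whole y.whole with h | h | h
    · exact Or.inl (Or.inl h)
    · exact (IsMVChain.le_or_le x.frac y.frac).imp (fun h' => Or.inr ⟨h, h'⟩)
        fun h' => Or.inr ⟨h.symm, h'⟩
    · exact Or.inr (Or.inl h)
  toDecidableLE := Classical.decRel _

instance : IsOrderedAddMonoid (ChangGroup C) where
  add_le_add_left x y h z := by
    rw [le_def] at h
    by_cases hx : x.frac + z.frac = ⊤ <;> by_cases hy : y.frac + z.frac = ⊤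
    · rw [add_of_eq hx, add_of_eq hy, le_def]
      simp only
      rcases h with h | ⟨h, ha⟩
      · left; omega
      · exact Or.inr ⟨by omega, tsub_le_tsub_right ha _⟩
    · rw [add_of_eq hx, add_of_ne hy, le_def]
      simp only
      rcases h with h | ⟨h, ha⟩
      -- The carry on the left can close a gap of one between the integral parts; the remainder is
      -- then at most `z.frac`, which settles the comparison.
      · rcases (Int.add_one_le_iff.2 h).lt_or_eq with h' | h'
        · left; omega
        · refine Or.inr ⟨by omega, ?_⟩
          rw [sub_compl_comm]
          exact tsub_le_self.trans le_add_self
      · exact absurd (top_le_iff.1 (hx ▸ add_le_add_left ha _)) hy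
    · rw [add_of_ne hx, add_of_eq hy, le_def]
      simp only
      left
      rcases h with h | ⟨h, ha⟩ <;> omega
    · rw [add_of_ne hx, add_of_ne hy, le_def]
      simp only
      rcases h with h | ⟨h, ha⟩
      · left; omega
      · exact Or.inr ⟨by omega, add_le_add_left ha _⟩

open Classical in
/-- The embedding of an MV-chain as the unit interval of its Chang group. -/
noncomputable def of (a : C) : ChangGroup C :=
  if h : a = ⊤ then ⟨1, 0, IsMVChain.zero_ne_top⟩ else ⟨0, a, h⟩

theorem of_top : of (⊤ : C) = ⟨1, 0, IsMVChain.zero_ne_top⟩ := dif_pos rfl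

theorem of_of_ne {a : C} (h : a ≠ ⊤) : of a = ⟨0, a, h⟩ := dif_neg h

@[simp] theorem of_zero : of (0 : C) = 0 := of_of_ne IsMVChain.zero_ne_top

theorem of_le_of {a b : C} : of a ≤ of b ↔ a ≤ b := by
  by_cases ha : a = ⊤ <;> by_cases hb : b = ⊤
  · subst ha; subst hb; simp
  · subst ha
    rw [of_top, of_of_ne hb, le_def]
    simp [hb]
  · subst hb
    rw [of_top, of_of_ne ha, le_def]
    simp
  · rw [of_of_ne ha, of_of_ne hb, le_def]
    simp

theorem of_nonneg (a : C) : 0 ≤ of a := by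
  rw [← of_zero, of_le_of]; exact zero_le

theorem of_add (a b : C) : of (a + b) = min (of ⊤) (of a + of b) := by
  by_cases ha : a = ⊤
  · subst ha
    rw [top_add', min_eq_left]
    exact le_add_of_nonneg_right (of_nonneg _)
  by_cases hb : b = ⊤
  · subst hb
    rw [add_top', min_eq_left]
    exact le_add_of_nonneg_left (of_nonneg _)
  rw [of_of_ne ha, of_of_ne hb]
  by_cases h : a + b = ⊤
  · rw [h, add_of_eq h, min_eq_left]
    rw [of_top, le_def]
    exact Or.inr ⟨rfl, zero_le⟩
  · rw [of_of_ne h, add_of_ne h, min_eq_right]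
    · rfl
    · rw [of_top, le_def]
      exact Or.inl zero_lt_one

theorem of_compl (a : C) : of aᶜ = of ⊤ - of a := by
  rw [eq_sub_iff_add_eq]
  by_cases ha : a = ⊤
  · subst ha
    rw [compl_top', of_zero, zero_add]
  by_cases h0 : aᶜ = ⊤
  · have : a = 0 := by rw [← compl_compl' a, h0, compl_top']
    rw [h0, this, of_zero, add_zero]
  · rw [of_of_ne ha, of_of_ne h0, of_top, add_of_eq (compl_add_self _)]
    ext
    · rfl
    · exact tsub_self _

/-- The Chang group is functorial for embeddings of MV-chains. -/
noncomputable def map {D : Type*} [MVAlgebra D] [IsMVChain D] (f : C → D) (hf : IsHom f)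
    (hinj : Function.Injective f) : ChangGroup C →+ ChangGroup D where
  toFun x := ⟨x.whole, f x.frac, fun h => x.frac_ne (hinj (h.trans hf.map_top.symm))⟩
  map_zero' := ChangGroup.ext rfl hf.map_zero
  map_add' x y := by
    by_cases h : x.frac + y.frac = ⊤
    · rw [add_of_eq h, add_of_eq (by simp only; rw [← hf.map_add, h, hf.map_top])]
      ext
      · rfl
      · simp only
        rw [hf.map_sub, hf.map_compl]
    · rw [add_of_ne h, add_of_ne (by
        simp only; rw [← hf.map_add, ← hf.map_top]; exact hinj.ne h)]
      ext
      · rfl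
      · exact hf.map_add _ _

variable {D : Type*} [MVAlgebra D] [IsMVChain D] {f : C → D} (hf : IsHom f)
  (hinj : Function.Injective f)

theorem map_strictMono : StrictMono (map f hf hinj) := by
  refine Monotone.strictMono_of_injective (fun x y h => ?_) fun x y h => ?_
  · rw [le_def] at *
    exact h.imp id (And.imp id fun h' => hf.monotone h')
  · exact ChangGroup.ext (congrArg whole h :) (hinj (congrArg frac h :))

theorem map_of (a : C) : map f hf hinj (of a) = of (f a) := by
  by_cases h : a = ⊤
  · subst h
    rw [hf.map_top, of_top, of_top]
    exact ChangGroup.ext rfl hf.map_zero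
  · rw [of_of_ne h, of_of_ne (hf.map_top ▸ hinj.ne h)]
    rfl

end ChangGroup

/-! ### Consistent systems of integral linear inequalities -/

/-- Finitely many lower and upper bounds, some of them strict, that are pairwise compatible have a
common solution. -/
theorem exists_between_bounds {α β : Type*} (F : Finset α) (G : Finset β) (l : α → ℚ) (w : β → ℚ)
    (sl : α → Prop) (sw : β → Prop) (hle : ∀ a ∈ F, ∀ b ∈ G, l a ≤ w b)
    (hlt : ∀ a ∈ F, ∀ b ∈ G, sl a ∨ sw b → l a < w b) :
    ∃ r : ℚ, (∀ a ∈ F, l a ≤ r ∧ (sl a → l a < r)) ∧ ∀ b ∈ G, r ≤ w b ∧ (sw b → r < w b) := by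
  rcases F.eq_empty_or_nonempty with rfl | hF
  · rcases G.eq_empty_or_nonempty with rfl | hG
    · exact ⟨0, by simp, by simp⟩
    · obtain ⟨b₀, _, hmin⟩ := G.exists_min_image w hG
      exact ⟨w b₀ - 1, by simp, fun b hb => ⟨by linarith [hmin b hb],
        fun _ => by linarith [hmin b hb]⟩⟩
  · obtain ⟨a₀, ha₀, hmax⟩ := F.exists_max_image l hF
    rcases G.eq_empty_or_nonempty with rfl | hG
    · exact ⟨l a₀ + 1, fun a ha => ⟨by linarith [hmax a ha],
        fun _ => by linarith [hmax a ha]⟩, by simp⟩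
    · obtain ⟨b₀, hb₀, hmin⟩ := G.exists_min_image w hG
      have h₀ := hle a₀ ha₀ b₀ hb₀
      -- The midpoint of the largest lower and the smallest upper bound may equal both; a strict
      -- bound is then excluded from being extremal by `hlt`.
      refine ⟨(l a₀ + w b₀) / 2, fun a ha => ⟨by linarith [hmax a ha], fun hs => ?_⟩,
        fun b hb => ⟨by linarith [hmin b hb], fun hs => ?_⟩⟩
      · linarith [hmax a ha, hlt a ha b₀ hb₀ (Or.inl hs)]
      · linarith [hmin b hb, hlt a₀ ha₀ b hb (Or.inr hs)]

/-- Consistent systems of integral linear inequalities: `P` holds the forms that are declared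
non-negative and `N` those that are declared positive. -/
structure IsLinearSystem {V : Type*} (P N : Set (V → ℤ)) : Prop where
  subset : N ⊆ P
  add_mem : ∀ {f g}, f ∈ P → g ∈ P → f + g ∈ P
  add_mem_left : ∀ {f g}, f ∈ N → g ∈ P → f + g ∈ N
  zero_notMem : (0 : V → ℤ) ∉ N

namespace IsLinearSystem

variable {V : Type*} {P N : Set (V → ℤ)}

theorem nsmul_mem (h : IsLinearSystem P N) {f : V → ℤ} (hf : f ∈ P) (n : ℕ) :
    (n + 1) • f ∈ P := by
  induction n with
  | zero => simpa using hf
  | succ n ih => rw [succ_nsmul]; exact h.add_mem ih hf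

theorem nsmul_mem_strict (h : IsLinearSystem P N) {f : V → ℤ} (hf : f ∈ N) (n : ℕ) :
    (n + 1) • f ∈ N := by
  induction n with
  | zero => simpa using hf
  | succ n ih => rw [succ_nsmul]; exact h.add_mem_left ih (h.subset hf)

theorem zsmul_mem (h : IsLinearSystem P N) {f : V → ℤ} (hf : f ∈ P) {n : ℤ} (hn : 0 < n) :
    n • f ∈ P := by
  obtain ⟨m, rfl⟩ := Int.eq_succ_of_zero_lt hn
  simpa using h.nsmul_mem hf m

theorem zsmul_mem_strict (h : IsLinearSystem P N) {f : V → ℤ} (hf : f ∈ N) {n : ℤ}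
    (hn : 0 < n) : n • f ∈ N := by
  obtain ⟨m, rfl⟩ := Int.eq_succ_of_zero_lt hn
  simpa using h.nsmul_mem_strict hf m

variable [Fintype V]

/-- Fourier-Motzkin elimination, one variable at a time. -/
theorem exists_rat_solution_of_support (h : IsLinearSystem P N) (s : Finset V)
    (T : Finset (V → ℤ)) (hTP : ∀ f ∈ T, f ∈ P) (hT : ∀ f ∈ T, ∀ v ∉ s, f v = 0) :
    ∃ x : V → ℚ, ∀ f ∈ T, 0 ≤ ∑ v, (f v : ℚ) * x v ∧ (f ∈ N → 0 < ∑ v, (f v : ℚ) * x v) := by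
  classical
  induction s using Finset.induction_on generalizing T with
  | empty =>
    refine ⟨0, fun f hf => ⟨by simp, fun hN => ?_⟩⟩
    have : f = 0 := funext fun v => hT f hf v (by simp)
    exact absurd (this ▸ hN) h.zero_notMem
  | insert v s hv ih =>
    let pos := T.filter fun f => 0 < f v
    let neg := T.filter fun f => f v < 0
    -- The multipliers are positive and cancel the coefficient of `v`; closure of `P` and `N` under
    -- such combinations keeps the new system consistent.
    let T' : Finset (V → ℤ) := T.filter (fun f => f v = 0) ∪
      (pos ×ˢ neg).image fun p => (-p.2 v) • p.1 + p.1 v • p.2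
    obtain ⟨x, hx⟩ := ih T' (by
        intro f hf
        simp only [T', pos, neg, Finset.mem_union, Finset.mem_filter, Finset.mem_image,
          Finset.mem_product, Prod.exists] at hf
        rcases hf with hf | ⟨f₁, f₂, ⟨⟨h1, h1'⟩, h2, h2'⟩, rfl⟩
        · exact hTP f hf.1
        · exact h.add_mem (h.zsmul_mem (hTP _ h1) (by omega)) (h.zsmul_mem (hTP _ h2) h1')) (by
        intro f hf w hw
        simp only [T', pos, neg, Finset.mem_union, Finset.mem_filter, Finset.mem_image,
          Finset.mem_product, Prod.exists] at hf
        by_cases hwv : w = v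
        · subst hwv
          rcases hf with hf | ⟨f₁, f₂, -, rfl⟩
          · exact hf.2
          · simp; ring
        · have hw' : w ∉ insert v s := by simp [hwv, hw]
          rcases hf with hf | ⟨f₁, f₂, ⟨⟨h1, -⟩, h2, -⟩, rfl⟩
          · exact hT f hf.1 w hw'
          · simp [hT _ h1 w hw', hT _ h2 w hw'])
    let ev : (V → ℤ) → ℚ := fun f => ∑ w, (f w : ℚ) * x w
    have ev_comb : ∀ (a b : ℤ) (f g : V → ℤ), ev (a • f + b • g) = a * ev f + b * ev g := by
      intro a b f g
      simp only [ev, Finset.mul_sum, ← Finset.sum_add_distrib]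
      refine Finset.sum_congr rfl fun w _ => ?_
      simp
      ring
    have hpair : ∀ f ∈ pos, ∀ g ∈ neg, 0 ≤ (-g v : ℤ) * ev f + f v * ev g ∧
        (f ∈ N ∨ g ∈ N → 0 < (-g v : ℤ) * ev f + f v * ev g) := by
      intro f hf g hg
      have hmem : (-g v) • f + f v • g ∈ T' :=
        Finset.mem_union_right _ (Finset.mem_image.2 ⟨(f, g), Finset.mem_product.2 ⟨hf, hg⟩, rfl⟩)
      simp only [pos, neg, Finset.mem_filter] at hf hg
      rw [← ev_comb]
      refine ⟨(hx _ hmem).1, fun hN => (hx _ hmem).2 ?_⟩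
      have hg' : 0 < -g v := by omega
      rcases hN with hN | hN
      · exact h.add_mem_left (h.zsmul_mem_strict hN hg') (h.zsmul_mem (hTP _ hg.1) hf.2)
      · rw [add_comm]
        exact h.add_mem_left (h.zsmul_mem_strict hN hf.2) (h.zsmul_mem (hTP _ hf.1) hg')
    have hdiv : ∀ f ∈ pos, ∀ g ∈ neg,
        ev g / (-g v : ℤ) - -ev f / f v = ((-g v : ℤ) * ev f + f v * ev g) / (f v * (-g v : ℤ)) ∧
        (0 : ℚ) < f v * (-g v : ℤ) := by
      intro f hf g hg
      simp only [pos, neg, Finset.mem_filter] at hf hg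
      have h1 : (0 : ℚ) < f v := by exact_mod_cast hf.2
      have h2 : (0 : ℚ) < (-g v : ℤ) := by exact_mod_cast (by omega : 0 < -g v)
      refine ⟨?_, by positivity⟩
      field_simp
      ring
    obtain ⟨r, hr₁, hr₂⟩ := exists_between_bounds pos neg (fun f => -ev f / f v)
      (fun g => ev g / (-g v : ℤ)) (· ∈ N) (· ∈ N)
      (fun f hf g hg => by
        rw [← sub_nonneg, (hdiv f hf g hg).1]
        exact div_nonneg (hpair f hf g hg).1 (hdiv f hf g hg).2.le)
      (fun f hf g hg hN => by
        rw [← sub_pos, (hdiv f hf g hg).1]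
        exact div_pos ((hpair f hf g hg).2 hN) (hdiv f hf g hg).2)
    -- Every pairwise compatibility of bounds on the shift of coordinate `v` is one of the combined
    -- inequalities, already solved by `x`.
    refine ⟨x + Pi.single v r, fun f hf => ?_⟩
    have hev : ∑ w, (f w : ℚ) * (x + Pi.single v r : V → ℚ) w = ev f + f v * r := by
      simp [ev, mul_add, Finset.sum_add_distrib, Pi.single_apply]
    rw [hev]
    rcases lt_trichotomy (f v) 0 with hfv | hfv | hfv
    · have hb := hr₂ f (Finset.mem_filter.2 ⟨hf, hfv⟩)
      have h2 : (0 : ℚ) < (-f v : ℤ) := by exact_mod_cast (by omega : 0 < -f v)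
      rw [le_div_iff₀ h2, lt_div_iff₀ h2] at hb
      push_cast at hb
      exact ⟨by linarith [hb.1], fun hN => by linarith [hb.2 hN]⟩
    · have := hx f (Finset.mem_union_left _ (Finset.mem_filter.2 ⟨hf, hfv⟩))
      simpa [hfv] using this
    · have hb := hr₁ f (Finset.mem_filter.2 ⟨hf, hfv⟩)
      have h2 : (0 : ℚ) < f v := by exact_mod_cast hfv
      rw [div_le_iff₀ h2, div_lt_iff₀ h2] at hb
      exact ⟨by linarith [hb.1], fun hN => by linarith [hb.2 hN]⟩

theorem exists_int_solution (h : IsLinearSystem P N) (T : Finset (V → ℤ)) :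
    ∃ x : V → ℤ, ∀ f ∈ T, (f ∈ P → 0 ≤ ∑ v, f v * x v) ∧ (f ∈ N → 0 < ∑ v, f v * x v) := by
  classical
  obtain ⟨x, hx⟩ := h.exists_rat_solution_of_support Finset.univ (T.filter (· ∈ P))
    (fun f hf => (Finset.mem_filter.1 hf).2) (fun f _ v hv => absurd (Finset.mem_univ v) hv)
  -- The inequalities are homogeneous, so clearing denominators preserves them.
  let D : ℕ := ∏ v, (x v).den
  have hD : (0 : ℚ) < D := by
    exact_mod_cast Finset.prod_pos fun v _ => (x v).den_pos
  have hint : ∀ v, ∃ n : ℤ, (n : ℚ) = D * x v := by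
    intro v
    obtain ⟨c, hc⟩ := Finset.dvd_prod_of_mem (fun v => (x v).den) (Finset.mem_univ v)
    refine ⟨(x v).num * c, ?_⟩
    have hq : (x v) * (x v).den = (x v).num := Rat.mul_den_eq_num (x v)
    simp only [D]
    rw [hc]
    push_cast
    rw [← hq]
    ring
  choose y hy using hint
  have hsum : ∀ f : V → ℤ, ((∑ v, f v * y v : ℤ) : ℚ) = D * ∑ v, (f v : ℚ) * x v := by
    intro f
    push_cast
    rw [Finset.mul_sum]
    refine Finset.sum_congr rfl fun v _ => ?_
    rw [hy]
    ring
  refine ⟨y, fun f hf => ⟨fun hP => ?_, fun hN => ?_⟩⟩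
  · have := (hx f (Finset.mem_filter.2 ⟨hf, hP⟩)).1
    have h' : (0 : ℚ) ≤ ((∑ v, f v * y v : ℤ) : ℚ) := by rw [hsum]; positivity
    exact_mod_cast h'
  · have := (hx f (Finset.mem_filter.2 ⟨hf, h.subset hN⟩)).2 hN
    have h' : (0 : ℚ) < ((∑ v, f v * y v : ℤ) : ℚ) := by rw [hsum]; positivity
    exact_mod_cast h'

end IsLinearSystem

/-! ### Integer realization over a common subgroup -/

/-- Finitely many totally ordered groups with a common subgroup: finitely many linear forms in
given elements keep their signs under a suitable simultaneous choice of integers, which agree on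
the elements that come from the common subgroup. -/
theorem exists_int_realization {ι σ G₀ : Type*} [Fintype ι] [Fintype σ]
    [AddCommGroup G₀] [LinearOrder G₀] [IsOrderedAddMonoid G₀] {G : ι → Type*}
    [∀ i, AddCommGroup (G i)] [∀ i, LinearOrder (G i)] [∀ i, IsOrderedAddMonoid (G i)]
    (e : ∀ i, G₀ →+ G i) (he : ∀ i, StrictMono (e i)) (g : ∀ i, σ → G i)
    (T : Finset (σ → ℤ)) :
    ∃ X : ι → σ → ℤ,
      (∀ i, ∀ f ∈ T, (0 ≤ ∑ s, f s • g i s → 0 ≤ ∑ s, f s * X i s) ∧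
        (0 < ∑ s, f s • g i s → 0 < ∑ s, f s * X i s)) ∧
      ∀ s, (∃ c, ∀ i, e i c = g i s) → ∀ i j, X i s = X j s := by
  classical
  -- The family `z` with sum `0` moves elements of `G₀` between the coordinates. Thus `P` is the
  -- pullback of the image of the product cone in the sum of the `G i` amalgamated over `G₀`.
  let ev : (ι × σ → ℤ) → (ι → G₀) → ∀ i, G i := fun f z i => ∑ s, f (i, s) • g i s + e i (z i)
  have ev_add : ∀ f f' z z', ev (f + f') (z + z') = ev f z + ev f' z' := by
    intro f f' z z'
    funext i
    simp only [ev, Pi.add_apply, add_smul, Finset.sum_add_distrib, map_add]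
    abel
  let P : Set (ι × σ → ℤ) := {f | ∃ z : ι → G₀, ∑ i, z i = 0 ∧ 0 ≤ ev f z}
  let N : Set (ι × σ → ℤ) := {f | ∃ z : ι → G₀, ∑ i, z i = 0 ∧ 0 < ev f z}
  have hsys : IsLinearSystem P N :=
    { subset := fun f ⟨z, hz, h⟩ => ⟨z, hz, h.le⟩
      add_mem := fun {f f'} ⟨z, hz, h⟩ ⟨z', hz', h'⟩ => ⟨z + z', by
        simp [Finset.sum_add_distrib, hz, hz'], by
        rw [ev_add]; exact add_nonneg h h'⟩
      add_mem_left := fun {f f'} ⟨z, hz, h⟩ ⟨z', hz', h'⟩ => ⟨z + z', by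
        simp [Finset.sum_add_distrib, hz, hz'], by
        rw [ev_add]; exact add_pos_of_pos_of_nonneg h h'⟩
      zero_notMem := by
        rintro ⟨z, hz, h⟩
        -- Consistency: non-negative elements of `G₀` with sum `0` all vanish, so no coordinate can
        -- be strictly positive.
        have hz0 : ∀ i, 0 ≤ z i := fun i => by
          have := h.le i
          simp only [ev, Pi.zero_apply, zero_smul, Finset.sum_const_zero, zero_add] at this
          rwa [← map_zero (e i), (he i).le_iff_le] at this
        rw [Finset.sum_eq_zero_iff_of_nonneg fun i _ => hz0 i] at hz
        refine h.ne' (funext fun i => ?_)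
        simp [ev, hz i (Finset.mem_univ i)] }
  let emb : ι → (σ → ℤ) → (ι × σ → ℤ) := fun i f p => if p.1 = i then f p.2 else 0
  let diff : σ → ι → ι → (ι × σ → ℤ) := fun s i j => Pi.single (i, s) 1 - Pi.single (j, s) 1
  obtain ⟨x, hx⟩ := hsys.exists_int_solution
    ((Finset.univ ×ˢ T).image (fun p => emb p.1 p.2) ∪
      Finset.univ.image fun p : σ × ι × ι => diff p.1 p.2.1 p.2.2)
  have ev_emb : ∀ i f, ev (emb i f) 0 = Pi.single i (∑ s, f s • g i s) := by
    intro i f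
    funext j
    by_cases h : j = i
    · subst h; simp [ev, emb]
    · simp [ev, emb, h]
  have sum_emb : ∀ i f, ∑ p, emb i f p * x p = ∑ s, f s * x (i, s) := by
    intro i f
    rw [Fintype.sum_prod_type, Finset.sum_eq_single i]
    · simp [emb]
    · intro j _ h; simp [emb, h]
    · simp
  have sum_diff : ∀ s i j, ∑ p, diff s i j p * x p = x (i, s) - x (j, s) := by
    intro s i j
    simp [diff, sub_mul, Pi.single_apply]
  refine ⟨fun i s => x (i, s), fun i f hf => ?_, fun s ⟨c, hc⟩ i j => ?_⟩
  · have := hx (emb i f) (Finset.mem_union_left _ (Finset.mem_image.2 ⟨(i, f), by simp [hf], rfl⟩))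
    rw [sum_emb] at this
    refine ⟨fun h => this.1 ⟨0, by simp, ?_⟩, fun h => this.2 ⟨0, by simp, ?_⟩⟩
    · rw [ev_emb]; simpa using h
    · rw [ev_emb]; simpa using h
  · have key : ∀ i j, 0 ≤ x (i, s) - x (j, s) := by
      intro i j
      rw [← sum_diff]
      refine (hx _ (Finset.mem_union_right _ (Finset.mem_image.2
        ⟨(s, i, j), by simp, rfl⟩))).1 ⟨Pi.single j c - Pi.single i c, by simp, ?_⟩
      refine le_of_eq (funext fun k => ?_)
      have h1 : ∀ j, ∑ t, (Pi.single (j, s) 1 : ι × σ → ℤ) (k, t) • g k t =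
          if k = j then g k s else 0 := by
        intro j
        rw [Finset.sum_eq_single s]
        · by_cases h : k = j <;> simp [h]
        · intro t _ ht; simp [ht]
        · simp
      have h2 : ∀ j, e k ((Pi.single j c : ι → G₀) k) = if k = j then g k s else 0 := by
        intro j
        by_cases h : k = j
        · subst h; simp [hc]
        · simp [h]
      simp only [ev, diff, Pi.sub_apply, sub_smul, Finset.sum_sub_distrib, map_sub, h1, h2]
      simp
    exact le_antisymm (sub_nonneg.1 (key j i)) (sub_nonneg.1 (key i j))

/-- Version of `exists_int_realization` for the relations `a + b ≤ c` and `c ≤ a + b`. -/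
theorem exists_int_order_realization {ι A G₀ : Type*} [Fintype ι]
    [AddCommGroup G₀] [LinearOrder G₀] [IsOrderedAddMonoid G₀] {G : ι → Type*}
    [∀ i, AddCommGroup (G i)] [∀ i, LinearOrder (G i)] [∀ i, IsOrderedAddMonoid (G i)]
    (e : ∀ i, G₀ →+ G i) (he : ∀ i, StrictMono (e i)) (g : ∀ i, A → G i) (S : Finset A) :
    ∃ Y : ι → A → ℤ,
      (∀ i, ∀ a ∈ S, ∀ b ∈ S, ∀ c ∈ S,
        (Y i a + Y i b ≤ Y i c ↔ g i a + g i b ≤ g i c) ∧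
        (Y i c ≤ Y i a + Y i b ↔ g i c ≤ g i a + g i b)) ∧
      ∀ s ∈ S, (∃ c, ∀ i, e i c = g i s) → ∀ i j, Y i s = Y j s := by
  classical
  -- Including both `F p` and `-F p`, with strict signs preserved, upgrades the implications to
  -- equivalences.
  let F : S × S × S → S → ℤ := fun p => Pi.single p.1 1 + Pi.single p.2.1 1 - Pi.single p.2.2 1
  obtain ⟨X, hX, hshared⟩ := exists_int_realization e he (fun i (s : S) => g i s)
    (Finset.univ.image F ∪ Finset.univ.image fun p => -F p)
  refine ⟨fun i a => if h : a ∈ S then X i ⟨a, h⟩ else 0, fun i a ha b hb c hc => ?_,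
    fun s hs hc i j => ?_⟩
  · let p : S × S × S := (⟨a, ha⟩, ⟨b, hb⟩, ⟨c, hc⟩)
    have h1 := hX i (F p) (Finset.mem_union_left _ (Finset.mem_image_of_mem _ (Finset.mem_univ _)))
    have h2 := hX i (-F p) (Finset.mem_union_right _
      (Finset.mem_image_of_mem (fun p => -F p) (Finset.mem_univ _)))
    have e1 : ∑ s, F p s • g i s = g i a + g i b - g i c := by
      simp [F, p, sub_smul, add_smul, Finset.sum_add_distrib, Pi.single_apply, ite_smul]
    have e2 : ∑ s, F p s * X i s = X i ⟨a, ha⟩ + X i ⟨b, hb⟩ - X i ⟨c, hc⟩ := by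
      simp [F, p, sub_mul, add_mul, Finset.sum_add_distrib, Pi.single_apply]
    simp only [Pi.neg_apply, neg_smul, neg_mul, Finset.sum_neg_distrib, e1, e2] at h1 h2
    simp only [sub_nonneg, sub_pos, neg_sub] at h1 h2
    simp only [ha, hb, hc, dif_pos]
    refine ⟨⟨fun h => ?_, h2.1⟩, fun h => ?_, h1.1⟩
    · by_contra! hcon
      exact absurd (h1.2 hcon) (not_lt.2 h)
    · by_contra! hcon
      exact absurd (h2.2 hcon) (not_lt.2 h)
  · simp only [hs, dif_pos]
    exact hshared ⟨s, hs⟩ hc i j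

open MVAlgebra

/-! ### Quantifiers and prime ideals with witnesses -/

/-- An MV-algebra with two quantifiers `ex` and `all`. The axiom
`∀(∃x ∨ y) = ∃x ∨ ∀y` of monadic MV-algebras is not listed: it is not needed for the
representation below. -/
class QuantifiedMVAlgebra (A : Type*) extends MVAlgebra A where
  ex : A → A
  all : A → A
  all_le : ∀ x : A, all x ≤ x
  all_compl_add_all : ∀ x y : A, all (xᶜ + all y) = (ex x)ᶜ + all y
  all_compl_all_add : ∀ x y : A, all ((all x)ᶜ + y) = (all x)ᶜ + all y
  ex_compl_add_compl : ∀ x : A, ex (xᶜ + xᶜ)ᶜ = ((ex x)ᶜ + (ex x)ᶜ)ᶜ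

namespace QuantifiedMVAlgebra

variable {A : Type*} [QuantifiedMVAlgebra A]

theorem all_zero : all (0 : A) = 0 := nonpos_iff_eq_zero.1 (all_le 0)

theorem all_compl (x : A) : all xᶜ = (ex x)ᶜ := by
  have h := all_compl_add_all x 0
  rwa [all_zero, add_zero, add_zero] at h

theorem ex_eq (x : A) : ex x = (all xᶜ)ᶜ := by rw [all_compl, compl_compl']

theorem le_ex (x : A) : x ≤ ex x := by
  rw [← compl_le_compl_iff', ← all_compl]
  exact all_le _

theorem all_top : all (⊤ : A) = ⊤ := by
  simpa [all_zero] using all_compl_all_add (0 : A) 0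

theorem all_all (x : A) : all (all x) = all x := by
  have h := all_compl_add_all (⊤ : A) x
  rwa [top_le_iff.1 (le_ex (⊤ : A)), compl_top', zero_add] at h

theorem ex_all (x : A) : ex (all x) = all x := by
  refine le_antisymm ?_ (le_ex _)
  have h := all_compl_add_all (all x) x
  rw [compl_add_self, all_top] at h
  exact le_iff_compl_add.2 h.symm

theorem all_mono {x y : A} (h : x ≤ y) : all x ≤ all y := by
  have h' := all_compl_all_add x y
  rw [le_iff_compl_add.1 ((all_le x).trans h), all_top] at h'
  exact le_iff_compl_add.2 h'.symm

theorem all_ex (x : A) : all (ex x) = ex x := by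
  rw [ex_eq, all_compl, ex_all]

/-- The dual of the axiom on `∃(x * x)`; it is what controls multiples of `∃t - t` below. -/
theorem all_add_self (x : A) : all (x + x) = all x + all x := by
  have h := ex_compl_add_compl xᶜ
  simp only [ex_eq, compl_compl'] at h
  simpa using congrArg compl h

theorem all_compl_of_fixed {x : A} (hx : all x = x) : all xᶜ = xᶜ := by
  rw [all_compl, ← hx, ex_all]

theorem all_add_of_fixed {x y : A} (hx : all x = x) (hy : all y = y) : all (x + y) = x + y := by
  have h := all_compl_all_add xᶜ y
  rwa [all_compl_of_fixed hx, compl_compl', hy] at h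

theorem all_sub_of_fixed {x y : A} (hx : all x = x) (hy : all y = y) : all (x - y) = x - y :=
  all_compl_of_fixed (all_add_of_fixed (all_compl_of_fixed hx) hy)

/-- The algebra of the elements that are fixed by the quantifiers. -/
@[ext]
structure Fixed (A : Type*) [QuantifiedMVAlgebra A] where
  /-- The underlying element. -/
  val : A
  all_val : all val = val

instance : Zero (Fixed A) := ⟨⟨0, all_zero⟩⟩

instance : Add (Fixed A) := ⟨fun x y => ⟨x.val + y.val, all_add_of_fixed x.2 y.2⟩⟩

instance : MVAlgebra (Fixed A) where
  add_assoc _ _ _ := Fixed.ext (add_assoc _ _ _)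
  zero_add _ := Fixed.ext (zero_add _)
  add_zero _ := Fixed.ext (add_zero _)
  nsmul := nsmulRec
  add_comm _ _ := Fixed.ext (add_comm _ _)
  compl x := ⟨x.valᶜ, all_compl_of_fixed x.2⟩
  compl_compl_eq _ := Fixed.ext (compl_compl' _)
  add_compl_zero _ := Fixed.ext (add_top' _)
  lukasiewicz _ _ := Fixed.ext (lukasiewicz _ _)

theorem Fixed.isHom_val : IsHom (Fixed.val : Fixed A → A) := ⟨rfl, fun _ _ => rfl, fun _ => rfl⟩

theorem Fixed.val_le_val {x y : Fixed A} : x.val ≤ y.val ↔ x ≤ y := by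
  rw [le_def, le_def, ← isHom_val.map_sub]
  exact (Fixed.ext_iff (y := 0)).symm

theorem ex_le_of_mem {x b : A} (hb : all b = b) (h : x ≤ b) : ex x ≤ b := by
  rw [ex_eq, ← compl_le_compl_iff', compl_compl', ← all_compl_of_fixed hb]
  exact all_mono (compl_le_compl' h)

/-- Algebraic form of "the supremum is approached": a fixed `m` below `∃t - t` satisfies `t ≤ ∃t -
m`, whose right side is fixed, so `∃t ≤ ∃t - m` and `m` must vanish. -/
theorem all_ex_sub_self (t : A) : all (ex t - t) = 0 := by
  set m := all (ex t - t)
  have hm : all m = m := all_all _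
  have hle : m ≤ ex t - t := all_le _
  have hmt : t ≤ mᶜ := by
    rw [← compl_le_compl_iff', compl_compl']
    exact hle.trans (by rw [← compl_sub_compl]; exact tsub_le_self)
  have h1 : t ≤ ex t - m := calc
    t = t + m - m := (add_sub_cancel_of_le hmt).symm
    _ ≤ ex t - t + t - m := by rw [add_comm t]; gcongr
    _ = ex t - m := by rw [sub_add_of_le (le_ex t)]
  have h2 : ex t ≤ ex t - m := ex_le_of_mem (all_sub_of_fixed (all_ex t) hm) h1
  rw [← nonpos_iff_eq_zero]
  calc m ≤ meet (ex t) m := le_meet (hle.trans tsub_le_self) le_rfl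
    _ = ex t - (ex t - m) := rfl
    _ = 0 := le_def.1 h2

theorem all_nsmul_eq_zero {w : A} (hw : all w = 0) (n : ℕ) : all (n • w) = 0 := by
  -- Only doubling is available, so `n` is bounded by a power of two.
  have h : all (2 ^ n • w) = 0 := by
    induction n with
    | zero => simpa using hw
    | succ n ih => rw [pow_succ, mul_two, add_nsmul, all_add_self, ih, add_zero]
  rw [← nonpos_iff_eq_zero, ← h]
  exact all_mono (nsmul_le_nsmul_left zero_le Nat.lt_two_pow_self.le)

/-- The ideal generated by `J` and `w = ∃t - t` contains no fixed element outside `J`: from `b ≤ q +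
n • w` with `b`, `q` fixed, applying `∀` to `b - q ≤ n • w` gives `b ≤ q`. The fixed elements
outside `J` are closed under meets because `J` is prime, so the prime ideal theorem applies. -/
theorem exists_isPrimeIdeal_witness {J : Set (Fixed A)} (hJ : IsPrimeIdeal J) (t : A) :
    ∃ I : Set A, IsPrimeIdeal I ∧ (∀ b : Fixed A, b.val ∈ I ↔ b ∈ J) ∧ ex t - t ∈ I := by
  set w := ex t - t
  obtain ⟨I, hI, hsub, hdisj⟩ := exists_isPrimeIdeal
    (I₀ := {z : A | ∃ q ∈ J, ∃ n : ℕ, z ≤ q.val + n • w}) (D := Fixed.val '' Jᶜ)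
    ⟨⟨0, hJ.zero_mem, 0, zero_le⟩, by
      rintro x y ⟨q, hq, n, h⟩ ⟨q', hq', n', h'⟩
      refine ⟨q + q', hJ.add_mem hq hq', n + n', (add_le_add h h').trans_eq ?_⟩
      rw [add_nsmul, Fixed.isHom_val.map_add, add_add_add_comm], by
      rintro x y hxy ⟨q, hq, n, h⟩
      exact ⟨q, hq, n, hxy.trans h⟩⟩
    ⟨_, ⊤, hJ.top_notMem, rfl⟩ (by
      rintro _ ⟨x, hx, rfl⟩ _ ⟨y, hy, rfl⟩
      exact ⟨meet x y, fun h => (hJ.mem_or_mem h).elim hx hy, rfl⟩) (by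
      rw [Set.disjoint_left]
      rintro _ ⟨q, hq, n, h⟩ ⟨b, hb, rfl⟩
      refine hb (hJ.mem_of_le (y := q) ?_ hq)
      have h1 : b.val - q.val ≤ n • w := tsub_le_iff_left.2 h
      have h2 := all_mono h1
      rw [all_nsmul_eq_zero (all_ex_sub_self t), all_sub_of_fixed b.2 q.2,
        nonpos_iff_eq_zero] at h2
      exact Fixed.val_le_val.1 (le_def.2 h2))
  refine ⟨I, hI, fun b => ⟨fun h => ?_, fun h => hsub ⟨b, h, 0, by simp⟩⟩,
    hsub ⟨0, hJ.zero_mem, 1, by simp⟩⟩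
  by_contra hb
  exact Set.disjoint_left.1 hdisj h ⟨b, hb, rfl⟩

theorem exists_isPrimeIdeal_fixed {x : A} (hx : x ≠ 0) :
    ∃ J : Set (Fixed A), IsPrimeIdeal J ∧ (⟨ex x, all_ex x⟩ : Fixed A) ∉ J := by
  obtain ⟨J, hJ, -, hdisj⟩ := exists_isPrimeIdeal (A := Fixed A) (I₀ := {0})
    (D := {⟨ex x, all_ex x⟩})
    ⟨rfl, by rintro _ _ rfl rfl; exact add_zero _, by
      rintro x y hxy rfl
      exact nonpos_iff_eq_zero.1 hxy⟩ (Set.singleton_nonempty _)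
    (by
      rintro _ rfl _ rfl
      exact le_antisymm (meet_le_left _ _) (le_meet le_rfl le_rfl))
    (by
      rw [Set.disjoint_singleton]
      intro h
      have : ex x = 0 := congrArg Fixed.val h.symm
      exact hx (nonpos_iff_eq_zero.1 ((le_ex x).trans this.le)))
  exact ⟨J, hJ, Set.disjoint_singleton_right.1 hdisj⟩

/-! ### Local homomorphisms into powers of finite chains -/

/-- On the finite set `S` the map `φ` behaves as a homomorphism to the algebra of all functions
from `ι` to the chain `{0, ..., m}`. -/
structure IsLocalHom {ι : Type*} (S : Finset A) (m : ℕ) (φ : ι → A → ℕ) : Prop where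
  le : ∀ i, ∀ a ∈ S, φ i a ≤ m
  zero : 0 ∈ S → ∀ i, φ i 0 = 0
  compl : ∀ a ∈ S, aᶜ ∈ S → ∀ i, φ i aᶜ = m - φ i a
  add : ∀ a ∈ S, ∀ b ∈ S, a + b ∈ S → ∀ i, φ i (a + b) = min m (φ i a + φ i b)
  le_ex : ∀ a ∈ S, ex a ∈ S → ∀ i j, φ i a ≤ φ j (ex a)
  ex_witness : ∀ a ∈ S, ex a ∈ S → ∀ j, ∃ i, φ i a = φ j (ex a)
  all_le : ∀ a ∈ S, all a ∈ S → ∀ i j, φ j (all a) ≤ φ i a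
  all_witness : ∀ a ∈ S, all a ∈ S → ∀ j, ∃ i, φ i a = φ j (all a)

/-- Finitely many prime ideals with the same trace on the fixed elements have a simultaneous
integral representation on a finite set. -/
theorem exists_int_values {ι : Type*} [Fintype ι] {J : Set (Fixed A)} (hJ : IsPrimeIdeal J)
    {I : ι → Set A} (hI : ∀ i, IsPrimeIdeal (I i))
    (hIJ : ∀ i, ∀ b : Fixed A, b.val ∈ I i ↔ b ∈ J) (S : Finset A) (h0 : 0 ∈ S) (h1 : ⊤ ∈ S) :
    ∃ Y : ι → A → ℤ, (∀ i, ∀ a ∈ S, ∀ b ∈ S, Y i a ≤ Y i b ↔ a - b ∈ I i) ∧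
      (∀ i, Y i 0 = 0) ∧
      (∀ i, ∀ a ∈ S, aᶜ ∈ S → Y i aᶜ = Y i ⊤ - Y i a) ∧
      (∀ i, ∀ a ∈ S, ∀ b ∈ S, a + b ∈ S → Y i (a + b) = min (Y i ⊤) (Y i a + Y i b)) ∧
      ∀ a ∈ S, all a = a → ∀ i j, Y i a = Y j a := by
  have hchain : ∀ i, IsMVChain (hI i).addCon.Quotient := fun i => (hI i).isMVChain
  have hchain₀ : IsMVChain hJ.addCon.Quotient := hJ.isMVChain
  have hmem : ∀ i (b b' : Fixed A), b.val - b'.val ∈ I i ↔ b - b' ∈ J := by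
    intro i b b'
    rw [← Fixed.isHom_val.map_sub, hIJ]
  -- The equal traces make the chain of fixed elements modulo `J` embed in every quotient; on Chang
  -- groups this gives the common subgroup.
  let f : ∀ i, hJ.addCon.Quotient → (hI i).addCon.Quotient := fun i =>
    Quotient.map' Fixed.val fun b b' h => ⟨(hmem i b b').2 h.1, (hmem i b' b).2 h.2⟩
  have hf : ∀ i, IsHom (f i) := fun i =>
    { map_zero := rfl
      map_add := fun x y => by
        induction x using Quotient.inductionOn'
        induction y using Quotient.inductionOn'
        rfl
      map_compl := fun x => by
        induction x using Quotient.inductionOn'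
        rfl }
  have hinj : ∀ i, Function.Injective (f i) := by
    intro i x y h
    induction x using Quotient.inductionOn' with | _ b
    induction y using Quotient.inductionOn' with | _ b'
    have h' := (AddCon.eq _).1 h
    exact (AddCon.eq _).2 ⟨(hmem i b b').1 h'.1, (hmem i b' b).1 h'.2⟩
  let g : ∀ i, A → ChangGroup (hI i).addCon.Quotient := fun i a =>
    ChangGroup.of (a : (hI i).addCon.Quotient)
  have g_le : ∀ i a b, g i a ≤ g i b ↔ a - b ∈ I i := fun i a b =>
    ChangGroup.of_le_of.trans (hI i).mk_le_mk
  have g_zero : ∀ i, g i 0 = 0 := fun i => ChangGroup.of_zero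
  have g_compl : ∀ i a, g i aᶜ = g i ⊤ - g i a := fun i a =>
    ChangGroup.of_compl (a : (hI i).addCon.Quotient)
  have g_add : ∀ i a b, g i (a + b) = min (g i ⊤) (g i a + g i b) := fun i a b =>
    ChangGroup.of_add (a : (hI i).addCon.Quotient) b
  obtain ⟨Y, hY, hshared⟩ := exists_int_order_realization
    (fun i => ChangGroup.map (f i) (hf i) (hinj i))
    (fun i => ChangGroup.map_strictMono (hf i) (hinj i)) g S
  have Y_zero : ∀ i, Y i 0 = 0 := by
    intro i
    have h := hY i 0 h0 0 h0 0 h0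
    simp only [g_zero, add_zero, le_refl, iff_true] at h
    omega
  have Y_le : ∀ i, ∀ a ∈ S, ∀ b ∈ S, Y i a ≤ Y i b ↔ g i a ≤ g i b := by
    intro i a ha b hb
    have h := (hY i a ha 0 h0 b hb).1
    rwa [Y_zero, g_zero, add_zero, add_zero] at h
  have Y_eq : ∀ i, ∀ a ∈ S, ∀ b ∈ S, g i a = g i b → Y i a = Y i b := fun i a ha b hb h =>
    le_antisymm ((Y_le i a ha b hb).2 h.le) ((Y_le i b hb a ha).2 h.ge)
  have Y_add : ∀ i, ∀ a ∈ S, ∀ b ∈ S, ∀ c ∈ S, g i a + g i b = g i c → Y i a + Y i b = Y i c :=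
    fun i a ha b hb c hc h =>
      le_antisymm ((hY i a ha b hb c hc).1.2 h.le) ((hY i a ha b hb c hc).2.2 h.ge)
  refine ⟨Y, fun i a ha b hb => (Y_le i a ha b hb).trans (g_le i a b), Y_zero,
    fun i a ha ha' => ?_, fun i a ha b hb hab => ?_, fun a ha hfix => hshared a ha
      ⟨ChangGroup.of ((⟨a, hfix⟩ : Fixed A) : hJ.addCon.Quotient), fun i =>
        ChangGroup.map_of (hf i) (hinj i) _⟩⟩
  · have := Y_add i aᶜ ha' a ha ⊤ h1 (by rw [g_compl, sub_add_cancel])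
    omega
  · rcases le_total (g i ⊤) (g i a + g i b) with h | h
    · rw [min_eq_left ((hY i a ha b hb ⊤ h1).2.2 h)]
      exact Y_eq i _ hab _ h1 (by rw [g_add, min_eq_left h])
    · rw [min_eq_right ((hY i a ha b hb ⊤ h1).1.2 h)]
      exact (Y_add i a ha b hb _ hab (by rw [g_add, min_eq_right h])).symm

/-- The coordinates are indexed by the elements to be witnessed: coordinate `a` attains `∃a`,
coordinate `aᶜ` attains `∀a`, and coordinate `x - y` separates `x` from `y`. -/
theorem exists_isLocalHom_of_sub_ne_zero {A : Type u} [QuantifiedMVAlgebra A] {x y : A}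
    (hxy : x - y ≠ 0) (S : Finset A) (hx : x ∈ S) (hy : y ∈ S) :
    ∃ (ι : Type u) (_ : Fintype ι) (_ : Nonempty ι) (m : ℕ) (φ : ι → A → ℕ),
      1 ≤ m ∧ IsLocalHom S m φ ∧ ∃ i, φ i x ≠ φ i y := by
  classical
  obtain ⟨J, hJ, hxJ⟩ := exists_isPrimeIdeal_fixed hxy
  choose I hI hIJ hw using exists_isPrimeIdeal_witness hJ
  let S' : Finset A := S ∪ S.image compl ∪ {0, ⊤, x - y}
  have hS : ∀ a ∈ S, a ∈ S' := fun a ha => by simp [S', ha]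
  have hS' : ∀ a ∈ S, aᶜ ∈ S' := fun a ha => by
    simp only [S', Finset.mem_union, Finset.mem_image]
    exact Or.inl (Or.inr ⟨a, ha, rfl⟩)
  have h0 : 0 ∈ S' := by simp [S']
  have h1 : ⊤ ∈ S' := by simp [S']
  have hsub : x - y ∈ S' := by simp [S']
  obtain ⟨Y, Y_le, Y_zero, Y_compl, Y_add, Y_fixed⟩ := exists_int_values (ι := S') hJ
    (I := fun i => I i) (fun i => hI i) (fun i => hIJ i) S' h0 h1
  have Y_mono : ∀ i, ∀ a ∈ S', ∀ b ∈ S', a ≤ b → Y i a ≤ Y i b := fun i a ha b hb h =>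
    (Y_le i a ha b hb).2 ((le_def.1 h).symm ▸ (hI i).zero_mem)
  have Y_top : ∀ i j, Y i ⊤ = Y j ⊤ := Y_fixed ⊤ h1 all_top
  have Y_nonneg : ∀ i, ∀ a ∈ S', 0 ≤ Y i a := fun i a ha =>
    (Y_zero i).symm.trans_le (Y_mono i 0 h0 a ha zero_le)
  have Y_le_top : ∀ i, ∀ a ∈ S', Y i a ≤ Y i ⊤ := fun i a ha => Y_mono i a ha ⊤ h1 le_top
  have ex_fixed : ∀ a ∈ S, ex a ∈ S → ∀ i j, Y i (ex a) = Y j (ex a) := fun a _ ha =>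
    Y_fixed _ (hS _ ha) (all_ex a)
  have all_fixed : ∀ a ∈ S, all a ∈ S → ∀ i j, Y i (all a) = Y j (all a) := fun a _ ha =>
    Y_fixed _ (hS _ ha) (all_all a)
  let i₀ : S' := ⟨0, h0⟩
  refine ⟨S', inferInstance, ⟨i₀⟩, (Y i₀ ⊤).toNat, fun i a => (Y i a).toNat, ?_,
    { le := fun i a ha => ?_
      zero := fun _ i => by simp [Y_zero]
      compl := fun a ha ha' i => ?_
      add := fun a ha b hb hab i => ?_
      le_ex := fun a ha ha' i j => ?_
      ex_witness := fun a ha ha' j => ⟨⟨a, hS a ha⟩, ?_⟩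
      all_le := fun a ha ha' i j => ?_
      all_witness := fun a ha ha' j => ⟨⟨aᶜ, hS' a ha⟩, ?_⟩ }, ⟨⟨x - y, hsub⟩, ?_⟩⟩
  · have h : ¬ Y i₀ ⊤ ≤ Y i₀ 0 := by
      rw [Y_le i₀ ⊤ h1 0 h0, tsub_zero]
      exact (hI _).top_notMem
    rw [Y_zero] at h
    omega
  · rw [Y_top i₀ i]
    exact Int.toNat_le_toNat (Y_le_top i a (hS a ha))
  · have := Y_nonneg i a (hS a ha)
    rw [Y_compl i a (hS a ha) (hS _ ha'), Y_top i₀ i]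
    omega
  · have := Y_nonneg i a (hS a ha)
    have := Y_nonneg i b (hS b hb)
    rw [Y_add i a (hS a ha) b (hS b hb) (hS _ hab), Y_top i₀ i]
    omega
  · rw [ex_fixed a ha ha' j i]
    exact Int.toNat_le_toNat (Y_mono i a (hS a ha) _ (hS _ ha') (le_ex a))
  · rw [ex_fixed a ha ha' j ⟨a, hS a ha⟩]
    refine congrArg _ (le_antisymm (Y_mono _ a (hS a ha) _ (hS _ ha') (le_ex a)) ?_)
    exact (Y_le _ _ (hS _ ha') a (hS a ha)).2 (hw a)
  · rw [all_fixed a ha ha' j i]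
    exact Int.toNat_le_toNat (Y_mono i _ (hS _ ha') a (hS a ha) (all_le a))
  · rw [all_fixed a ha ha' j ⟨aᶜ, hS' a ha⟩]
    refine congrArg _ (le_antisymm ?_ (Y_mono _ _ (hS _ ha') a (hS a ha) (all_le a)))
    refine (Y_le _ a (hS a ha) _ (hS _ ha')).2 ?_
    have h := hw aᶜ
    rwa [ex_eq, compl_compl', compl_sub_compl] at h
  · intro h
    have h' : Y ⟨x - y, hsub⟩ x ≤ Y ⟨x - y, hsub⟩ y := by
      beta_reduce at h
      have := Y_nonneg ⟨x - y, hsub⟩ x (hS x hx)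
      have := Y_nonneg ⟨x - y, hsub⟩ y (hS y hy)
      omega
    rw [Y_le _ x (hS x hx) y (hS y hy)] at h'
    -- If the values agreed, `x - y` would lie in the ideal together with `∃(x - y) - (x - y)`,
    -- hence so would `∃(x - y)`, against the choice of `J`.
    refine hxJ ((hIJ _ _).1 ((hI (x - y)).mem_of_le ?_ ((hI _).add_mem (hw _) h')))
    rw [sub_add_of_le (le_ex _)]

theorem exists_isLocalHom {A : Type u} [QuantifiedMVAlgebra A] {x y : A}
    (hxy : x ≠ y) (S : Finset A) (hx : x ∈ S) (hy : y ∈ S) :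
    ∃ (ι : Type u) (_ : Fintype ι) (_ : Nonempty ι) (m : ℕ) (φ : ι → A → ℕ),
      1 ≤ m ∧ IsLocalHom S m φ ∧ ∃ i, φ i x ≠ φ i y := by
  by_cases h : x - y = 0
  · have h' : y - x ≠ 0 := fun h' => hxy (le_antisymm (le_def.2 h) (le_def.2 h'))
    obtain ⟨ι, hι, hne, m, φ, hm, hφ, i, hi⟩ := exists_isLocalHom_of_sub_ne_zero h' S hy hx
    exact ⟨ι, hι, hne, m, φ, hm, hφ, i, hi.symm⟩
  · exact exists_isLocalHom_of_sub_ne_zero h S hx hy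

end QuantifiedMVAlgebra

/-! ### Transfer of a failing quasi-identity -/

section Terms

variable {L : FirstOrder.Language} {M N α : Type*} [L.Structure M] [L.Structure N]

/-- The values of all subterms of a term. -/
def subtermValues (v : α → M) : L.Term α → Set M
  | .var a => {v a}
  | .func f ts => insert ((Term.func f ts).realize v) (⋃ i, subtermValues v (ts i))

theorem finite_subtermValues (v : α → M) (t : L.Term α) : (subtermValues v t).Finite := by
  induction t with
  | var a => exact Set.finite_singleton _
  | func f ts ih => exact (Set.finite_iUnion ih).insert _

theorem realize_mem_subtermValues (v : α → M) (t : L.Term α) :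
    t.realize v ∈ subtermValues v t := by
  cases t with
  | var a => exact rfl
  | func f ts => exact Set.mem_insert _ _

theorem map_realize_of_subtermValues_subset (v : α → M) (φ : M → N) (S : Set M)
    (hφ : ∀ (n : ℕ) (f : L.Functions n) (a : Fin n → M), (∀ i, a i ∈ S) →
      Structure.funMap f a ∈ S → φ (Structure.funMap f a) = Structure.funMap f (φ ∘ a))
    (t : L.Term α) (ht : subtermValues v t ⊆ S) : φ (t.realize v) = t.realize (φ ∘ v) := by
  induction t with
  | var a => rfl
  | func f ts ih =>
    have hts : ∀ i, subtermValues v (ts i) ⊆ S := fun i =>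
      (Set.subset_iUnion (fun i => subtermValues v (ts i)) i).trans
        ((Set.subset_insert _ _).trans ht)
    have h := hφ _ f (fun i => (ts i).realize v)
      (fun i => hts i (realize_mem_subtermValues v (ts i))) (ht (Set.mem_insert _ _))
    refine h.trans (congrArg _ (funext fun i => ?_))
    exact ih i (hts i)

end Terms

namespace MonadicMV

section Operations

variable {A : Type u} [monadicMVLang.Structure A]

theorem funMap_zero (a : Fin 0 → A) :
    Structure.funMap (L := monadicMVLang) MonadicMVFunc.zero a = zero :=
  congrArg _ (Subsingleton.elim _ _)

theorem funMap_neg (a : Fin 1 → A) :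
    Structure.funMap (L := monadicMVLang) MonadicMVFunc.neg a = neg (a 0) :=
  congrArg _ (funext fun i => by fin_cases i; rfl)

theorem funMap_plus (a : Fin 2 → A) :
    Structure.funMap (L := monadicMVLang) MonadicMVFunc.plus a = plus (a 0) (a 1) :=
  congrArg _ (funext fun i => by fin_cases i <;> rfl)

theorem funMap_ex (a : Fin 1 → A) :
    Structure.funMap (L := monadicMVLang) MonadicMVFunc.ex a = ex (a 0) :=
  congrArg _ (funext fun i => by fin_cases i; rfl)

theorem funMap_all (a : Fin 1 → A) :
    Structure.funMap (L := monadicMVLang) MonadicMVFunc.all a = all (a 0) :=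
  congrArg _ (funext fun i => by fin_cases i; rfl)

/-- The quantified MV-algebra underlying a monadic MV-algebra. -/
abbrev IsMonadicMV.toQuantifiedMVAlgebra (h : IsMonadicMV A) : QuantifiedMVAlgebra A where
  zero := zero
  add := plus
  add_assoc x y z := (h.plus_assoc x y z).symm
  add_comm := h.plus_comm
  add_zero := h.plus_zero
  zero_add x := (h.plus_comm _ _).trans (h.plus_zero x)
  nsmul := letI : Zero A := ⟨zero⟩; letI : Add A := ⟨plus⟩; nsmulRec
  nsmul_zero _ := rfl
  nsmul_succ _ _ := rfl
  compl := neg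
  compl_compl_eq := h.neg_neg
  add_compl_zero := h.plus_one
  lukasiewicz := h.lukasiewicz
  ex := ex
  all := all
  all_le x := congrArg neg (h.m1 x) |>.trans (h.neg_neg _)
  all_compl_add_all := h.m2
  all_compl_all_add := h.m3
  ex_compl_add_compl := h.m5

end Operations

end MonadicMV

/-- `j` represents the chain `{0, ..., m}` as a subalgebra of `C`. -/
structure IsChainEmbedding {C : Type} [LinearOrder C] [MVOps C] (m : ℕ) (j : ℕ → C) : Prop where
  mono : ∀ {a b : ℕ}, a ≤ b → b ≤ m → j a ≤ j b
  inj : ∀ {a b : ℕ}, a ≤ m → b ≤ m → j a = j b → a = b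
  map_zero : j 0 = MVOps.zero
  map_compl : ∀ {a : ℕ}, a ≤ m → j (m - a) = MVOps.neg (j a)
  map_add : ∀ {a b : ℕ}, a ≤ m → b ≤ m → j (min m (a + b)) = MVOps.plus (j a) (j b)

/-- One statement for all three families: `ι` and `m` depend only on the failure in `A`, while the
chain `C` and the exponent `X` remain free. Since `π` is onto and extrema over `ι` are attained,
suprema and infima over `X`, even infinite, are the required values. -/
theorem QuasiIdentity.exists_not_holdsIn (q : QuasiIdentity) (A : MonadicMVAlg.{u})
    (hA : A ∈ MMV) (hq : ¬ q.HoldsIn A) :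
    ∃ (ι : Type u) (_ : Fintype ι) (_ : Nonempty ι) (m : ℕ), 1 ≤ m ∧
      ∀ (C : Type) [CompleteLinearOrder C] [MVOps C] (j : ℕ → C), IsChainEmbedding m j →
        ∀ (X : Type u) (π : X → ι), Function.Surjective π →
          ¬ q.HoldsIn (functionAlgebra C X) := by
  classical
  let _ : QuantifiedMVAlgebra A := MonadicMV.IsMonadicMV.toQuantifiedMVAlgebra hA
  simp only [QuasiIdentity.HoldsIn, not_forall] at hq
  obtain ⟨v, hprem, hne⟩ := hq
  have hfin : ((⋃ p ∈ q.premises, subtermValues v p.1 ∪ subtermValues v p.2) ∪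
      (subtermValues v q.lhs ∪ subtermValues v q.rhs)).Finite :=
    ((List.finite_toSet q.premises).biUnion fun p _ =>
      (finite_subtermValues v p.1).union (finite_subtermValues v p.2)).union
      ((finite_subtermValues v q.lhs).union (finite_subtermValues v q.rhs))
  set S := hfin.toFinset with hS
  have hSp : ∀ p ∈ q.premises, subtermValues v p.1 ⊆ S ∧ subtermValues v p.2 ⊆ S := by
    intro p hp
    rw [hS, hfin.coe_toFinset, ← Set.union_subset_iff]
    exact (Set.subset_biUnion_of_mem (u := fun p : _ × _ =>
      subtermValues v p.1 ∪ subtermValues v p.2) hp).trans Set.subset_union_left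
  have hSc : subtermValues v q.lhs ⊆ S ∧ subtermValues v q.rhs ⊆ S := by
    rw [hS, hfin.coe_toFinset, ← Set.union_subset_iff]
    exact Set.subset_union_right
  obtain ⟨ι, hι, hιne, m, φ, hm, hφ, i₀, hi₀⟩ := QuantifiedMVAlgebra.exists_isLocalHom hne S
    (hSc.1 (realize_mem_subtermValues _ _)) (hSc.2 (realize_mem_subtermValues _ _))
  refine ⟨ι, hι, hιne, m, hm, fun C _ _ j hj X π hπ hold => ?_⟩
  let _ : monadicMVLang.Structure (X → C) := functionStructure C X
  let Φ : A → X → C := fun a x => j (φ (π x) a)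
  have hΦ : ∀ (n : ℕ) (f : monadicMVLang.Functions n) (a : Fin n → A),
      (∀ i, a i ∈ (S : Set A)) → Structure.funMap f a ∈ (S : Set A) →
        Φ (Structure.funMap f a) = Structure.funMap f (Φ ∘ a) := by
    intro n f a ha hfa
    cases f with
    | zero =>
      rw [MonadicMV.funMap_zero] at hfa ⊢
      funext x
      change j (φ (π x) 0) = MVOps.zero
      rw [hφ.zero hfa, hj.map_zero]
    | neg =>
      rw [MonadicMV.funMap_neg] at hfa ⊢
      funext x
      change j (φ (π x) (a 0)ᶜ) = MVOps.neg (j (φ (π x) (a 0)))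
      rw [hφ.compl _ (ha 0) hfa, hj.map_compl (hφ.le _ _ (ha 0))]
    | plus =>
      rw [MonadicMV.funMap_plus] at hfa ⊢
      funext x
      change j (φ (π x) (a 0 + a 1)) = MVOps.plus (j (φ (π x) (a 0))) (j (φ (π x) (a 1)))
      rw [hφ.add _ (ha 0) _ (ha 1) hfa, hj.map_add (hφ.le _ _ (ha 0)) (hφ.le _ _ (ha 1))]
    | ex =>
      rw [MonadicMV.funMap_ex] at hfa ⊢
      funext x
      change j (φ (π x) (QuantifiedMVAlgebra.ex (a 0))) = ⨆ y, j (φ (π y) (a 0))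
      refine le_antisymm ?_ (iSup_le fun y =>
        hj.mono (hφ.le_ex _ (ha 0) hfa _ _) (hφ.le _ _ hfa))
      obtain ⟨i, hi⟩ := hφ.ex_witness _ (ha 0) hfa (π x)
      obtain ⟨y, rfl⟩ := hπ i
      rw [← hi]
      exact le_iSup (fun y => j (φ (π y) (a 0))) y
    | all =>
      rw [MonadicMV.funMap_all] at hfa ⊢
      funext x
      change j (φ (π x) (QuantifiedMVAlgebra.all (a 0))) = ⨅ y, j (φ (π y) (a 0))
      refine le_antisymm (le_iInf fun y =>
        hj.mono (hφ.all_le _ (ha 0) hfa _ _) (hφ.le _ _ (ha 0))) ?_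
      obtain ⟨i, hi⟩ := hφ.all_witness _ (ha 0) hfa (π x)
      obtain ⟨y, rfl⟩ := hπ i
      rw [← hi]
      exact iInf_le (fun y => j (φ (π y) (a 0))) y
  have hreal : ∀ t : monadicMVLang.Term ℕ, subtermValues v t ⊆ S →
      Φ (t.realize v) = t.realize (Φ ∘ v) :=
    map_realize_of_subtermValues_subset v Φ S hΦ
  have hconc := hold (Φ ∘ v) fun p hp => by
    have h := congrArg Φ (hprem p hp)
    rwa [hreal _ (hSp p hp).1, hreal _ (hSp p hp).2] at h
  have hconc' : Φ (q.lhs.realize v) = Φ (q.rhs.realize v) := by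
    rw [hreal _ hSc.1, hreal _ hSc.2]
    exact hconc
  obtain ⟨x, rfl⟩ := hπ i₀
  exact hi₀ (hj.inj (hφ.le _ _ (hSc.1 (realize_mem_subtermValues _ _)))
    (hφ.le _ _ (hSc.2 (realize_mem_subtermValues _ _))) (congrFun hconc' x))

/-! ### The generating algebras are monadic MV-algebras -/

/-- A complete chain with MV-operations that satisfy the laws of MV-algebras and induce its
order. -/
structure IsCompleteMVChain (C : Type) [CompleteLinearOrder C] [MVOps C] : Prop where
  plus_assoc : ∀ x y z : C, MVOps.plus x (MVOps.plus y z) = MVOps.plus (MVOps.plus x y) z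
  plus_comm : ∀ x y : C, MVOps.plus x y = MVOps.plus y x
  plus_zero : ∀ x : C, MVOps.plus x MVOps.zero = x
  neg_neg : ∀ x : C, MVOps.neg (MVOps.neg x) = x
  plus_one : ∀ x : C, MVOps.plus x (MVOps.neg MVOps.zero) = MVOps.neg MVOps.zero
  lukasiewicz : ∀ x y : C, MVOps.plus (MVOps.neg (MVOps.plus (MVOps.neg x) y)) y =
    MVOps.plus (MVOps.neg (MVOps.plus (MVOps.neg y) x)) x
  le_iff : ∀ x y : C, x ≤ y ↔ MVOps.plus (MVOps.neg x) y = MVOps.neg MVOps.zero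

namespace IsCompleteMVChain

open MVOps

variable {C : Type} [CompleteLinearOrder C] [MVOps C]

/-- Residuation: both sides say that the product of `a` and `b` is at most `c`. With `mul_le_iff` it
yields the exchange laws between implication and infima or suprema. -/
theorem le_imp_comm (h : IsCompleteMVChain C) (a b c : C) :
    a ≤ plus (neg b) c ↔ b ≤ plus (neg a) c := by
  rw [h.le_iff, h.le_iff, h.plus_assoc, h.plus_assoc, h.plus_comm (neg a)]

theorem mul_le_iff (h : IsCompleteMVChain C) (a b c : C) :
    neg (plus (neg a) (neg b)) ≤ c ↔ a ≤ plus (neg b) c := by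
  rw [h.le_iff, h.le_iff, h.neg_neg, h.plus_assoc]

theorem join_eq_sup (h : IsCompleteMVChain C) (a b : C) :
    plus (neg (plus (neg a) b)) b = a ⊔ b := by
  have key : ∀ a b : C, a ≤ b → plus (neg (plus (neg a) b)) b = b := fun a b hab => by
    rw [(h.le_iff a b).1 hab, h.neg_neg, h.plus_comm, h.plus_zero]
  rcases le_total a b with hab | hab
  · rw [key a b hab, sup_eq_right.2 hab]
  · rw [h.lukasiewicz, key b a hab, sup_eq_left.2 hab]

theorem iInf_imp (h : IsCompleteMVChain C) {X : Type u} (f : X → C) (c : C) :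
    ⨅ x, plus (neg (f x)) c = plus (neg (⨆ x, f x)) c :=
  eq_of_forall_le_iff fun t => by
    simp only [le_iInf_iff, h.le_imp_comm t, iSup_le_iff]

theorem iInf_imp' (h : IsCompleteMVChain C) {X : Type u} (f : X → C) (c : C) :
    ⨅ x, plus (neg c) (f x) = plus (neg c) (⨅ x, f x) :=
  eq_of_forall_le_iff fun t => by
    simp only [le_iInf_iff, ← h.mul_le_iff t]

theorem iInf_join (h : IsCompleteMVChain C) {X : Type u} (c : C) (f : X → C) :
    ⨅ x, plus (neg (plus (neg c) (f x))) (f x) =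
      plus (neg (plus (neg c) (⨅ x, f x))) (⨅ x, f x) := by
  simp only [h.join_eq_sup, sup_iInf_eq]

/-- In a chain the product of `f x` and `f y` is at most the square of the larger one, so the
squares already have the supremum of all products. -/
theorem iSup_mul_self (h : IsCompleteMVChain C) {X : Type u} (f : X → C) :
    ⨆ x, neg (plus (neg (f x)) (neg (f x))) = neg (plus (neg (⨆ x, f x)) (neg (⨆ x, f x))) :=
  eq_of_forall_ge_iff fun t => by
    rw [iSup_le_iff, h.mul_le_iff, iSup_le_iff]
    simp only [h.le_imp_comm _ (⨆ x, f x), iSup_le_iff, h.mul_le_iff]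
    refine ⟨fun hx x y => ?_, fun hx x => hx x x⟩
    rcases le_total (f x) (f y) with hxy | hxy
    · rw [h.le_imp_comm]
      exact hxy.trans (hx y)
    · exact hxy.trans (hx x)

theorem functionAlgebra_mem_MMV (h : IsCompleteMVChain C) (X : Type u) :
    functionAlgebra C X ∈ MMV where
  plus_assoc _ _ _ := funext fun _ => h.plus_assoc _ _ _
  plus_comm _ _ := funext fun _ => h.plus_comm _ _
  plus_zero _ := funext fun _ => h.plus_zero _
  neg_neg _ := funext fun _ => h.neg_neg _
  plus_one _ := funext fun _ => h.plus_one _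
  lukasiewicz _ _ := funext fun _ => h.lukasiewicz _ _
  m1 f := funext fun x => (h.le_iff _ _).1 (iInf_le f x)
  m2 f g := funext fun _ => h.iInf_imp f (⨅ y, g y)
  m3 f g := funext fun _ => h.iInf_imp' g (⨅ y, f y)
  m4 f g := funext fun _ => h.iInf_join (⨆ y, f y) g
  m5 f := funext fun _ => h.iSup_mul_self f

end IsCompleteMVChain

theorem isCompleteMVChain_fin (m : ℕ) : IsCompleteMVChain (Fin (m + 1)) := by
  have hneg : ∀ x : Fin (m + 1), ((MVOps.neg x : Fin (m + 1)) : ℕ) = m - x := fun _ => rfl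
  have hplus : ∀ x y : Fin (m + 1), ((MVOps.plus x y : Fin (m + 1)) : ℕ) = min m (x + y) :=
    fun _ _ => rfl
  have hzero : ((MVOps.zero : Fin (m + 1)) : ℕ) = 0 := rfl
  constructor
  all_goals
    intros
    simp only [Fin.ext_iff, Fin.le_def, hneg, hplus, hzero]
    omega

theorem isCompleteMVChain_unitInterval : IsCompleteMVChain unitInterval := by
  have hneg : ∀ x : unitInterval, ((MVOps.neg x : unitInterval) : ℝ) = 1 - x := fun _ => rfl
  have hplus : ∀ x y : unitInterval, ((MVOps.plus x y : unitInterval) : ℝ) = min 1 (x + y : ℝ) :=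
    fun _ _ => rfl
  have hzero : ((MVOps.zero : unitInterval) : ℝ) = 0 := rfl
  constructor
  · intro x y z
    have := x.2.1; have := z.2.1
    rw [Subtype.ext_iff]
    simp only [hplus, min_def]
    split_ifs <;> linarith
  · intro x y
    rw [Subtype.ext_iff, hplus, hplus, add_comm]
  · intro x
    rw [Subtype.ext_iff, hplus, hzero, add_zero, min_eq_right x.2.2]
  · intro x
    rw [Subtype.ext_iff, hneg, hneg, sub_sub_cancel]
  · intro x
    rw [Subtype.ext_iff, hplus, hneg, hzero, sub_zero, min_eq_left]
    linarith [x.2.1]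
  · intro x y
    have := x.2.1; have := x.2.2; have := y.2.1; have := y.2.2
    rw [Subtype.ext_iff]
    simp only [hplus, hneg, min_def]
    split_ifs <;> linarith
  · intro x y
    rw [Subtype.ext_iff, ← Subtype.coe_le_coe, hplus, hneg, hneg, hzero, sub_zero, min_eq_left_iff]
    constructor <;> intro h <;> linarith

theorem isChainEmbedding_fin (m : ℕ) : IsChainEmbedding m (Fin.ofNat (m + 1)) where
  mono {a b} hab hb := by
    rw [Fin.le_def, Fin.val_ofNat, Fin.val_ofNat, Nat.mod_eq_of_lt (by omega),
      Nat.mod_eq_of_lt (by omega)]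
    exact hab
  inj {a b} ha hb h := by
    rwa [Fin.ext_iff, Fin.val_ofNat, Fin.val_ofNat, Nat.mod_eq_of_lt (by omega),
      Nat.mod_eq_of_lt (by omega)] at h
  map_zero := rfl
  map_compl {a} ha := by
    rw [Fin.ext_iff, Fin.val_ofNat, Nat.mod_eq_of_lt (by omega)]
    change m - a = m - a % (m + 1)
    rw [Nat.mod_eq_of_lt (by omega)]
  map_add {a b} ha hb := by
    rw [Fin.ext_iff, Fin.val_ofNat, Nat.mod_eq_of_lt (by omega)]
    change min m (a + b) = min m (a % (m + 1) + b % (m + 1))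
    rw [Nat.mod_eq_of_lt (by omega), Nat.mod_eq_of_lt (by omega)]

theorem exists_isChainEmbedding_unitInterval {m : ℕ} (hm : 1 ≤ m) :
    ∃ j : ℕ → unitInterval, IsChainEmbedding m j := by
  have hm' : (0 : ℝ) < m := by exact_mod_cast hm
  -- Truncation at `1` only makes `j` total; it has no effect for `a ≤ m`.
  let j : ℕ → unitInterval := fun a => ⟨min 1 (a / m : ℝ), by positivity, min_le_left _ _⟩
  have hj : ∀ {a}, a ≤ m → (j a : ℝ) = a / m := fun {a} ha =>
    min_eq_right ((div_le_one hm').2 (by exact_mod_cast ha))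
  refine ⟨j, fun {a b} hab hb => ?_, fun {a b} ha hb h => ?_, ?_, fun {a} ha => ?_,
    fun {a b} ha hb => ?_⟩
  · rw [← Subtype.coe_le_coe, hj (hab.trans hb), hj hb]
    gcongr
  · rw [Subtype.ext_iff, hj ha, hj hb, div_left_inj' hm'.ne'] at h
    exact_mod_cast h
  · rw [Subtype.ext_iff, hj (Nat.zero_le m), Nat.cast_zero, zero_div]
    rfl
  · rw [Subtype.ext_iff, hj (Nat.sub_le m a), Nat.cast_sub ha, sub_div, div_self hm'.ne']
    change _ = 1 - (j a : ℝ)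
    rw [hj ha]
  · rw [Subtype.ext_iff, hj (min_le_left _ _)]
    change _ = min 1 ((j a : ℝ) + j b)
    rw [hj ha, hj hb, Nat.cast_min, ← min_div_div_right hm'.le, div_self hm'.ne', Nat.cast_add,
      add_div]

/-! ### Axiomatization of `MMV` and the three generation results -/

section Axiomatization

/-- The term `0`. -/
def zeroTerm : monadicMVLang.Term ℕ := Term.func MonadicMVFunc.zero ![]

/-- The term `¬ t`. -/
def negTerm (t : monadicMVLang.Term ℕ) : monadicMVLang.Term ℕ := Term.func MonadicMVFunc.neg ![t]

/-- The term `s ⊕ t`. -/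
def plusTerm (s t : monadicMVLang.Term ℕ) : monadicMVLang.Term ℕ :=
  Term.func MonadicMVFunc.plus ![s, t]

/-- The term `∃ t`. -/
def exTerm (t : monadicMVLang.Term ℕ) : monadicMVLang.Term ℕ := Term.func MonadicMVFunc.ex ![t]

/-- The term `∀ t`. -/
def allTerm (t : monadicMVLang.Term ℕ) : monadicMVLang.Term ℕ := Term.func MonadicMVFunc.all ![t]

/-- The term `s → t`. -/
def impTerm (s t : monadicMVLang.Term ℕ) : monadicMVLang.Term ℕ := plusTerm (negTerm s) t

/-- The term `s * t`. -/
def mulTerm (s t : monadicMVLang.Term ℕ) : monadicMVLang.Term ℕ :=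
  negTerm (plusTerm (negTerm s) (negTerm t))

/-- The term `s ∨ t`. -/
def joinTerm (s t : monadicMVLang.Term ℕ) : monadicMVLang.Term ℕ := impTerm (impTerm s t) t

variable {A : Type u} [monadicMVLang.Structure A] (v : ℕ → A) (s t : monadicMVLang.Term ℕ)

theorem realize_zeroTerm : zeroTerm.realize v = MonadicMV.zero := MonadicMV.funMap_zero _

theorem realize_negTerm : (negTerm t).realize v = MonadicMV.neg (t.realize v) :=
  MonadicMV.funMap_neg _

theorem realize_plusTerm :
    (plusTerm s t).realize v = MonadicMV.plus (s.realize v) (t.realize v) :=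
  MonadicMV.funMap_plus _

theorem realize_exTerm : (exTerm t).realize v = MonadicMV.ex (t.realize v) :=
  MonadicMV.funMap_ex _

theorem realize_allTerm : (allTerm t).realize v = MonadicMV.all (t.realize v) :=
  MonadicMV.funMap_all _

theorem realize_impTerm : (impTerm s t).realize v = MonadicMV.imp (s.realize v) (t.realize v) := by
  rw [impTerm, realize_plusTerm, realize_negTerm, MonadicMV.imp]

theorem realize_mulTerm : (mulTerm s t).realize v = MonadicMV.mul (s.realize v) (t.realize v) := by
  simp only [mulTerm, realize_plusTerm, realize_negTerm, MonadicMV.mul]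

theorem realize_joinTerm :
    (joinTerm s t).realize v = MonadicMV.join (s.realize v) (t.realize v) := by
  simp only [joinTerm, realize_impTerm, MonadicMV.join]

/-- The pairs of terms of the defining identities of monadic MV-algebras. -/
def monadicMVIdentities : Set (monadicMVLang.Term ℕ × monadicMVLang.Term ℕ) :=
  let x : monadicMVLang.Term ℕ := Term.var 0
  let y : monadicMVLang.Term ℕ := Term.var 1
  let z : monadicMVLang.Term ℕ := Term.var 2
  let one := negTerm zeroTerm
  {(plusTerm x (plusTerm y z), plusTerm (plusTerm x y) z),
    (plusTerm x y, plusTerm y x),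
    (plusTerm x zeroTerm, x),
    (negTerm (negTerm x), x),
    (plusTerm x one, one),
    (plusTerm (negTerm (plusTerm (negTerm x) y)) y, plusTerm (negTerm (plusTerm (negTerm y) x)) x),
    (impTerm (allTerm x) x, one),
    (allTerm (impTerm x (allTerm y)), impTerm (exTerm x) (allTerm y)),
    (allTerm (impTerm (allTerm x) y), impTerm (allTerm x) (allTerm y)),
    (allTerm (joinTerm (exTerm x) y), joinTerm (exTerm x) (allTerm y)),
    (exTerm (mulTerm x x), mulTerm (exTerm x) (exTerm x))}

end Axiomatization

theorem isQuasivariety_MMV : IsQuasivariety MMV.{u} := by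
  refine ⟨(fun p => ⟨[], p.1, p.2⟩) '' monadicMVIdentities, Set.ext fun A => ?_⟩
  have hiff : (∀ q ∈ (fun p => (⟨[], p.1, p.2⟩ : QuasiIdentity)) '' monadicMVIdentities,
      q.HoldsIn A) ↔ ∀ p ∈ monadicMVIdentities, ∀ v : ℕ → A, p.1.realize v = p.2.realize v :=
    Set.forall_mem_image.trans (forall₂_congr fun _ _ =>
      ⟨fun h v => h v (by simp), fun h v _ => h v⟩)
  refine Iff.trans ?_ hiff.symm
  simp only [monadicMVIdentities, Set.mem_insert_iff, Set.mem_singleton_iff, forall_eq_or_imp,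
    forall_eq, realize_zeroTerm, realize_negTerm, realize_plusTerm, realize_exTerm,
    realize_allTerm, realize_impTerm, realize_mulTerm, realize_joinTerm, Term.realize_var]
  constructor
  · intro h
    exact ⟨fun _ => h.plus_assoc _ _ _, fun _ => h.plus_comm _ _, fun _ => h.plus_zero _,
      fun _ => h.neg_neg _, fun _ => h.plus_one _, fun _ => h.lukasiewicz _ _, fun _ => h.m1 _,
      fun _ => h.m2 _ _, fun _ => h.m3 _ _, fun _ => h.m4 _ _, fun _ => h.m5 _⟩
  · rintro ⟨h1, h2, h3, h4, h5, h6, h7, h8, h9, h10, h11⟩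
    let w : A → A → A → ℕ → A := fun x y z n => if n = 0 then x else if n = 1 then y else z
    exact
      { plus_assoc := fun x y z => h1 (w x y z)
        plus_comm := fun x y => h2 (w x y y)
        plus_zero := fun x => h3 (w x x x)
        neg_neg := fun x => h4 (w x x x)
        plus_one := fun x => h5 (w x x x)
        lukasiewicz := fun x y => h6 (w x y y)
        m1 := fun x => h7 (w x x x)
        m2 := fun x y => h8 (w x y y)
        m3 := fun x y => h9 (w x y y)
        m4 := fun x y => h10 (w x y y)
        m5 := fun x => h11 (w x x x) }

theorem isGeneratedAsQuasivarietyBy_MMV {K : Set MonadicMVAlg.{u}} (hK : K ⊆ MMV)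
    (hfail : ∀ q : QuasiIdentity, ∀ A ∈ MMV.{u}, ¬ q.HoldsIn A → ∃ B ∈ K, ¬ q.HoldsIn B) :
    IsGeneratedAsQuasivarietyBy MMV.{u} K := by
  refine ⟨⟨isQuasivariety_MMV, hK⟩, ?_⟩
  rintro R ⟨⟨Θ, rfl⟩, hR⟩ A hA q hq
  by_contra hcon
  obtain ⟨B, hB, hqB⟩ := hfail q A hA hcon
  exact hqB (hR hB q hq)

theorem mainTheorem7 :
    IsGeneratedAsQuasivarietyBy MMV.{u}
      {A | ∃ m : ℕ, 1 ≤ m ∧ A = functionAlgebra (Fin (m + 1)) (ULift.{u} ℕ)} ∧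
    IsGeneratedAsQuasivarietyBy MMV.{u}
      {A | ∃ k : ℕ, 1 ≤ k ∧ A = functionAlgebra unitInterval (ULift.{u} (Fin k))} ∧
    IsGeneratedAsQuasivarietyBy MMV.{u}
      {functionAlgebra unitInterval (ULift.{u} ℕ)} := by
  have hsurj : ∀ (ι : Type u) [Fintype ι] [Nonempty ι],
      ∃ π : ULift.{u} ℕ → ι, Function.Surjective π := fun ι _ _ => by
    obtain ⟨f, hf⟩ := exists_surjective_nat ι
    exact ⟨f ∘ ULift.down, hf.comp ULift.down_surjective⟩
  refine ⟨isGeneratedAsQuasivarietyBy_MMV ?_ ?_, isGeneratedAsQuasivarietyBy_MMV ?_ ?_,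
    isGeneratedAsQuasivarietyBy_MMV ?_ ?_⟩
  · rintro _ ⟨m, -, rfl⟩
    exact (isCompleteMVChain_fin m).functionAlgebra_mem_MMV _
  · intro q A hA hq
    obtain ⟨ι, _, _, m, hm, h⟩ := q.exists_not_holdsIn A hA hq
    obtain ⟨π, hπ⟩ := hsurj ι
    exact ⟨_, ⟨m, hm, rfl⟩, h _ _ (isChainEmbedding_fin m) _ π hπ⟩
  · rintro _ ⟨k, -, rfl⟩
    exact isCompleteMVChain_unitInterval.functionAlgebra_mem_MMV _
  · intro q A hA hq
    obtain ⟨ι, _, _, m, hm, h⟩ := q.exists_not_holdsIn A hA hq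
    obtain ⟨j, hj⟩ := exists_isChainEmbedding_unitInterval hm
    -- Here the exponent must be finite, so `ι` itself serves, up to a bijection with `Fin k`.
    exact ⟨_, ⟨Fintype.card ι, Fintype.card_pos, rfl⟩, h _ j hj _
      (Equiv.ulift.trans (Fintype.equivFin ι).symm) (Equiv.surjective _)⟩
  · rintro _ rfl
    exact isCompleteMVChain_unitInterval.functionAlgebra_mem_MMV _
  · intro q A hA hq
    obtain ⟨ι, _, _, m, hm, h⟩ := q.exists_not_holdsIn A hA hq
    obtain ⟨j, hj⟩ := exists_isChainEmbedding_unitInterval hm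
    obtain ⟨π, hπ⟩ := hsurj ι
    exact ⟨_, rfl, h _ j hj _ π hπ⟩
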